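/- Fix a critical exponent $\alpha>1$. For $c\in(0,1)$ and $u,v\in[0,1]$ let the standard Lorenz map $q:[0,1]\setminus\{c\}\to[0,1]$ be $$q(x)=\begin{cases}u\left(1-\left(\frac{c-x}{c}\right)^{\alpha}\right), & x\in[0,c),\\[2pt] 1+v\left(-1+\left(\frac{x-c}{1-c}\right)^{\alpha}\right), & x\in(c,1].\end{cases}$$ A Lorenz map with critical point $c$ is a map $f:[0,1]\setminus\{c\}\to[0,1]$ with $f=\phi_-\circ q$ on $[0,c)$ and $f=\phi_+\circ q$ on $(c,1]$, where the diffeomorphic parts $\phi_\pm$ are increasing $C^3$ diffeomorphisms of $[0,1]$ with nonpositive Schwarzian derivative, such that $f(c^+)<c<f(c^-)$ (one-sided limits) and the only fixed points of $f$ are $0$ and $1$. It is full if both of its branches, extended to $[0,c]$ and $[c,1]$ by these one-sided limits, map onto $[0,1]$, i.e. $f(c^-)=1$ and $f(c^+)=0$. It is $\epsilon$-close to standard maps if the $C^2$-distance on $[0,1]$ of each of $\phi_-$ and $\phi_+$ to the identity is at most $\epsilon$. There exists $\epsilon>0$ (depending only on $\alpha$) with the following property. For every $K>0$ there exists $w>0$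 such that every full Lorenz map $f$ with critical exponent $\alpha$ which is $\epsilon$-close to standard maps and whose critical point satisfies $c\in[\frac1K,1-\frac1K]$ has a unique invariant probability measure $\mu$ on $[0,1]$ that is absolutely continuous with respect to Lebesgue measure, and $$\mu([0,c])\ge w\quad\text{and}\quad \mu([c,1])\ge w.$$ -/

import Mathlib

open Set MeasureTheory

noncomputable section

namespace Lorenz

/-- The Schwarzian derivative `φ'''/φ' - (3/2) (φ''/φ')²` of a function on `[0,1]`
(one-sided derivatives at the end points). -/
def schwarzian (φ : ℝ → ℝ) (x : ℝ) : ℝ :=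
  iteratedDerivWithin 3 φ (Icc 0 1) x / iteratedDerivWithin 1 φ (Icc 0 1) x -
    3 / 2 * (iteratedDerivWithin 2 φ (Icc 0 1) x / iteratedDerivWithin 1 φ (Icc 0 1) x) ^ 2

/-- `φ` restricts to an increasing `C³` diffeomorphism of `[0,1]` with nonpositive Schwarzian
derivative. (The identity, whose Schwarzian derivative vanishes, is allowed; values of `φ`
outside `[0,1]` are irrelevant.) -/
structure IsDiffeoPart (φ : ℝ → ℝ) : Prop where
  contDiffOn : ContDiffOn ℝ 3 φ (Icc 0 1)
  bijOn : BijOn φ (Icc 0 1) (Icc 0 1)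
  deriv_pos : ∀ x ∈ Icc (0 : ℝ) 1, 0 < iteratedDerivWithin 1 φ (Icc 0 1) x
  schwarzian_nonpos : ∀ x ∈ Icc (0 : ℝ) 1, schwarzian φ x ≤ 0

/-- The `C²`-distance on `[0,1]` between `φ` and the identity is at most `ε`. -/
def C2CloseToId (ε : ℝ) (φ : ℝ → ℝ) : Prop :=
  ∀ x ∈ Icc (0 : ℝ) 1,
    |φ x - x| ≤ ε ∧
    |iteratedDerivWithin 1 φ (Icc 0 1) x - 1| ≤ ε ∧
    |iteratedDerivWithin 2 φ (Icc 0 1) x| ≤ ε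

/-- The left branch, on `[0,c]`, of the standard Lorenz map with critical exponent `α`. Its value
at `c` is the limit of the standard map from the left. -/
def stdLeft (α c u x : ℝ) : ℝ := u * (1 - ((c - x) / c) ^ α)

/-- The right branch, on `[c,1]`, of the standard Lorenz map with critical exponent `α`. Its value
at `c` is the limit of the standard map from the right. -/
def stdRight (α c v x : ℝ) : ℝ := 1 + v * (-1 + ((x - c) / (1 - c)) ^ α)

/-- The left branch `φ₋ ∘ q` on `[0,c]`. -/
def leftBranch (α c u : ℝ) (φ : ℝ → ℝ) (x : ℝ) : ℝ := φ (stdLeft α c u x)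

/-- The right branch `φ₊ ∘ q` on `[c,1]`. -/
def rightBranch (α c v : ℝ) (φ : ℝ → ℝ) (x : ℝ) : ℝ := φ (stdRight α c v x)

/-- The map on `[0,1] \ {c}` made of the two branches; its value at `c` and outside `[0,1]` is
irrelevant. -/
def lorenzFun (α c u v : ℝ) (φl φr : ℝ → ℝ) (x : ℝ) : ℝ :=
  if x < c then leftBranch α c u φl x else rightBranch α c v φr x

end Lorenz

/-- A Lorenz map with critical exponent `α`: it has `C³` diffeomorphic parts with nonpositive
Schwarzian derivative, is nontrivial, and has no fixed points other than `0` and `1`. -/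
structure LorenzMap (α : ℝ) where
  /-- the critical point -/
  c : ℝ
  /-- the critical values of the standard map are `u` and `1 - v` -/
  u : ℝ
  v : ℝ
  /-- the left diffeomorphic part -/
  φl : ℝ → ℝ
  /-- the right diffeomorphic part -/
  φr : ℝ → ℝ
  c_mem : c ∈ Ioo (0 : ℝ) 1
  u_mem : u ∈ Icc (0 : ℝ) 1
  v_mem : v ∈ Icc (0 : ℝ) 1
  diffeo_left : Lorenz.IsDiffeoPart φl
  diffeo_right : Lorenz.IsDiffeoPart φr
  nontrivial : Lorenz.rightBranch α c v φr c < c ∧ c < Lorenz.leftBranch α c u φl c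
  fixed_points : ∀ x ∈ Icc (0 : ℝ) 1 \ {c},
    Lorenz.lorenzFun α c u v φl φr x = x → x = 0 ∨ x = 1

namespace LorenzMap

variable {α : ℝ}

/-- The underlying map; only its values on `[0,1] \ {c}` matter. -/
def toFun (f : LorenzMap α) : ℝ → ℝ := Lorenz.lorenzFun α f.c f.u f.v f.φl f.φr

/-- Both branches map onto `[0,1]`. -/
def IsFull (f : LorenzMap α) : Prop :=
  Lorenz.leftBranch α f.c f.u f.φl '' Icc 0 f.c = Icc 0 1 ∧
  Lorenz.rightBranch α f.c f.v f.φr '' Icc f.c 1 = Icc 0 1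

/-- `f` is `ε`-close to standard maps. -/
def CloseToStandard (ε : ℝ) (f : LorenzMap α) : Prop :=
  Lorenz.C2CloseToId ε f.φl ∧ Lorenz.C2CloseToId ε f.φr

/-- `μ` is an invariant probability measure on `[0,1]` of `f`, absolutely continuous with respect
to Lebesgue measure on `[0,1]` (so that the single point `c`, where `f` is undefined, is null). -/
structure IsACIP (f : LorenzMap α) (μ : Measure ℝ) : Prop where
  prob : IsProbabilityMeasure μ
  absCont : μ ≪ volume.restrict (Icc 0 1)
  invariant : ∀ A : Set ℝ, MeasurableSet A → μ {x ∈ Icc (0 : ℝ) 1 \ {f.c} | f.toFun x ∈ A} = μ A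

end LorenzMap

end

open Filter Topology

noncomputable section

namespace Lorenz

/-! The proof transports densities instead of following orbits. Nonpositive Schwarzian derivative
gives a one-sided Koebe principle, used here as two monotonicity statements that compose
(`KoebeBranch.comp`). The matching conditions on a density h, that x²h(x) increases and (1-x)²h(x)
decreases, are then preserved by the transfer operator of a map with two full Koebe branches
(`KoebeMeasure.map_branch`). They amount to a Harnack inequality: on [δ,1-δ] the density is at most
δ⁻² times the total mass, and any mass found in [δ,1-δ] bounds the density from below on all of
(0,1).

Mass could escape only to the fixed points 0 and 1. These expand uniformly: if the derivatives of
the diffeomorphic parts are at least a, the expansion near them is at least ab, for any b < α, and a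
is chosen with ab > 1. New mass near 0 or 1 comes only from a neighbourhood of the critical point,
where Harnack applies and the preimage of an interval of length t has length of order t^(1/α).
Summing a geometric series bounds the mass of all iterates of Lebesgue measure near 0 and 1
uniformly (`FullSystem.tail_le`), with constants depending only on α and K.

Hence the iterates are uniformly absolutely continuous, so a limit of their averages is an
absolutely continuous invariant probability, and its density is at least δ²/2; this yields w. For
uniqueness, every Koebe measure eventually spreads over (0,1) in proportion to its mass. Applied to
Lebesgue measure on a cylinder pushed onto (0,1), this shows that an invariant set of positive
measure fills a fixed proportion of every cylinder. Cylinders shrink, so by Lebesgue density the set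
has full measure (`FullSystem.ergodic`), and an ergodic measure equivalent to Lebesgue measure
leaves no room for another. -/

theorem monotoneOn_of_hasDerivAt_nonneg {D : Set ℝ} (hD : Convex ℝ D) {f f' : ℝ → ℝ}
    (hf : ContinuousOn f D) (hf' : ∀ x ∈ interior D, HasDerivAt f (f' x) x)
    (h0 : ∀ x ∈ interior D, 0 ≤ f' x) : MonotoneOn f D :=
  monotoneOn_of_deriv_nonneg hD hf
    (fun x hx => (hf' x hx).differentiableAt.differentiableWithinAt)
    fun x hx => by rw [(hf' x hx).deriv]; exact h0 x hx

theorem strictMonoOn_of_hasDerivAt_pos {D : Set ℝ} (hD : Convex ℝ D) {f f' : ℝ → ℝ}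
    (hf : ContinuousOn f D) (hf' : ∀ x ∈ interior D, HasDerivAt f (f' x) x)
    (h0 : ∀ x ∈ interior D, 0 < f' x) : StrictMonoOn f D :=
  strictMonoOn_of_deriv_pos hD hf fun x hx => by rw [(hf' x hx).deriv]; exact h0 x hx

theorem antitoneOn_mul_of_nonneg {f g : ℝ → ℝ} {s : Set ℝ} (hf : AntitoneOn f s)
    (hg : AntitoneOn g s) (hf0 : ∀ x ∈ s, 0 ≤ f x) (hg0 : ∀ x ∈ s, 0 ≤ g x) :
    AntitoneOn (f * g) s :=
  fun _ ha _ hb h => mul_le_mul (hf ha hb h) (hg ha hb h) (hg0 _ hb) (hf0 _ ha)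

/-! ### One-sided Koebe principle. -/

/-- The one-sided Koebe principle in infinitesimal form. Here `d = φ'`, `Q = φ''/φ'` and `R = Q'`,
so that `R ≤ Q²/2` says that the Schwarzian derivative of `φ` is nonpositive. -/
theorem monotoneOn_sq_div_of_schwarzian {φ d Q R : ℝ → ℝ} (hφ0 : φ 0 = 0)
    (hφc : ContinuousOn φ (Ico 0 1)) (hdc : ContinuousOn d (Ico 0 1))
    (hQc : ContinuousOn Q (Ico 0 1))
    (hφ : ∀ z ∈ Ioo (0 : ℝ) 1, HasDerivAt φ (d z) z)
    (hd : ∀ z ∈ Ioo (0 : ℝ) 1, HasDerivAt d (d z * Q z) z)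
    (hQ : ∀ z ∈ Ioo (0 : ℝ) 1, HasDerivAt Q (R z) z)
    (hpos : ∀ z ∈ Ico (0 : ℝ) 1, 0 < d z)
    (hR : ∀ z ∈ Ioo (0 : ℝ) 1, R z ≤ Q z ^ 2 / 2) :
    MonotoneOn (fun z => φ z ^ 2 / (d z * z ^ 2)) (Ioo 0 1) := by
  have hint : interior (Ico (0 : ℝ) 1) = Ioo 0 1 := interior_Ico
  have hsub : Ioo (0 : ℝ) 1 ⊆ Ico 0 1 := Ioo_subset_Ico_self
  have hφmono : StrictMonoOn φ (Ico 0 1) :=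
    strictMonoOn_of_hasDerivAt_pos (convex_Ico 0 1) hφc (by rwa [hint])
      (by rw [hint]; exact fun z hz => hpos z (hsub hz))
  have hφpos : ∀ z ∈ Ioo (0 : ℝ) 1, 0 < φ z := fun z hz => by
    have := hφmono (left_mem_Ico.2 one_pos) (hsub hz) hz.1
    rwa [hφ0] at this
  -- The logarithmic derivative of the quotient is V/(zφ), so it suffices that V ≥ 0. Dividing by √d
  -- removes the first-order term: (V/√d)' = φ z (Q²/2 - R)/√d ≥ 0, and V vanishes at 0.
  let V : ℝ → ℝ := fun z => 2 * z * d z - φ z * (z * Q z + 2)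
  have hV : ∀ z ∈ Ioo (0 : ℝ) 1, 0 ≤ V z := by
    have hm : MonotoneOn (fun z => V z / √(d z)) (Ico 0 1) := by
      refine monotoneOn_of_hasDerivAt_nonneg (convex_Ico 0 1)
        (f' := fun z => φ z * z * (Q z ^ 2 / 2 - R z) / √(d z)) ?_ ?_ ?_
      · refine ContinuousOn.div ?_ hdc.sqrt fun z hz => (Real.sqrt_pos.2 (hpos z hz)).ne'
        exact ((continuousOn_const.mul continuousOn_id).mul hdc).sub
          (hφc.mul ((continuousOn_id.mul hQc).add continuousOn_const))
      · rw [hint]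
        intro z hz
        have hdz := hpos z (hsub hz)
        have hs := Real.sqrt_pos.2 hdz
        have h1 := (((hasDerivAt_id z).const_mul 2).mul (hd z hz)).sub
          ((hφ z hz).mul (((hasDerivAt_id z).mul (hQ z hz)).add_const 2))
        have h2 := h1.div ((hd z hz).sqrt hdz.ne') hs.ne'
        refine h2.congr_deriv ?_
        have hsq : √(d z) ^ 2 = d z := Real.sq_sqrt hdz.le
        simp only [id, Pi.mul_apply, Pi.sub_apply]
        field_simp
        rw [hsq]
        ring
      · rw [hint]
        intro z hz
        have := hR z hz
        exact div_nonneg (mul_nonneg (mul_nonneg (hφpos z hz).le hz.1.le) (by linarith))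
          (Real.sqrt_nonneg _)
    intro z hz
    have h := hm (left_mem_Ico.2 one_pos) (hsub hz) hz.1.le
    have h0 : V 0 = 0 := by simp [V, hφ0]
    simp only [h0, zero_div] at h
    have hs := Real.sqrt_pos.2 (hpos z (hsub hz))
    by_contra hneg
    exact absurd h (not_le.2 (div_neg_of_neg_of_pos (not_le.1 hneg) hs))
  refine monotoneOn_of_hasDerivAt_nonneg (convex_Ioo 0 1)
    (f' := fun z => φ z * V z / (d z * z ^ 3)) ?_ ?_ ?_
  · refine ((hφc.mono hsub).pow 2).div ((hdc.mono hsub).mul (continuousOn_id.pow 2)) fun z hz => ?_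
    exact (mul_pos (hpos z (hsub hz)) (pow_pos hz.1 2)).ne'
  · rw [interior_Ioo]
    intro z hz
    have hdz := hpos z (hsub hz)
    have hz0 := hz.1
    have h := ((hφ z hz).pow 2).div ((hd z hz).mul ((hasDerivAt_id z).pow 2))
      (mul_pos hdz (pow_pos hz.1 2)).ne'
    refine h.congr_deriv ?_
    simp only [id, V, Pi.mul_apply, Pi.pow_apply]
    field_simp
    push_cast
    ring
  · rw [interior_Ioo]
    intro z hz
    exact div_nonneg (mul_nonneg (hφpos z hz).le (hV z hz))
      (mul_pos (hpos z (hsub hz)) (pow_pos hz.1 3)).le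

/-! ### Branches satisfying both Koebe inequalities. -/

/-- A monotone branch from `[p,q]` onto `[0,1]` satisfying the two one-sided Koebe principles. -/
structure KoebeBranch (p q : ℝ) (f f' : ℝ → ℝ) : Prop where
  lt : p < q
  cont : ContinuousOn f (Icc p q)
  left : f p = 0
  right : f q = 1
  hasDeriv : ∀ x ∈ Ioo p q, HasDerivAt f (f' x) x
  pos : ∀ x ∈ Ioo p q, 0 < f' x
  koebe_left : MonotoneOn (fun x => f x ^ 2 / (f' x * (x - p) ^ 2)) (Ioo p q)
  koebe_right : AntitoneOn (fun x => (1 - f x) ^ 2 / (f' x * (q - x) ^ 2)) (Ioo p q)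

namespace KoebeBranch

variable {p q : ℝ} {f f' : ℝ → ℝ}

theorem strictMonoOn (h : KoebeBranch p q f f') : StrictMonoOn f (Icc p q) :=
  strictMonoOn_of_hasDerivAt_pos (convex_Icc p q) h.cont
    (by rw [interior_Icc]; exact h.hasDeriv) (by rw [interior_Icc]; exact h.pos)

theorem mapsTo (h : KoebeBranch p q f f') : MapsTo f (Ioo p q) (Ioo 0 1) := fun x hx => by
  have h1 := h.strictMonoOn (left_mem_Icc.2 h.lt.le) (Ioo_subset_Icc_self hx) hx.1
  have h2 := h.strictMonoOn (Ioo_subset_Icc_self hx) (right_mem_Icc.2 h.lt.le) hx.2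
  rw [h.left] at h1
  rw [h.right] at h2
  exact ⟨h1, h2⟩

theorem mapsTo_Icc (h : KoebeBranch p q f f') : MapsTo f (Icc p q) (Icc 0 1) := fun x hx => by
  have h1 := h.strictMonoOn.monotoneOn (left_mem_Icc.2 h.lt.le) hx hx.1
  have h2 := h.strictMonoOn.monotoneOn hx (right_mem_Icc.2 h.lt.le) hx.2
  rw [h.left] at h1
  rw [h.right] at h2
  exact ⟨h1, h2⟩

theorem exists_eq (h : KoebeBranch p q f f') {y : ℝ} (hy : y ∈ Icc (0 : ℝ) 1) :
    ∃ x ∈ Icc p q, f x = y := by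
  have := intermediate_value_Icc h.lt.le h.cont
  rw [h.left, h.right] at this
  exact this hy

theorem exists_eq_Ioo (h : KoebeBranch p q f f') {y : ℝ} (hy : y ∈ Ioo (0 : ℝ) 1) :
    ∃ x ∈ Ioo p q, f x = y := by
  obtain ⟨x, hx, rfl⟩ := h.exists_eq (Ioo_subset_Icc_self hy)
  refine ⟨x, ⟨lt_of_le_of_ne hx.1 ?_, lt_of_le_of_ne hx.2 ?_⟩, rfl⟩
  · rintro rfl
    exact hy.1.ne' h.left
  · rintro rfl
    exact hy.2.ne h.right

theorem congr_fun (h : KoebeBranch p q f f') {g : ℝ → ℝ} (hg : EqOn g f (Icc p q)) :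
    KoebeBranch p q g f' where
  lt := h.lt
  cont := h.cont.congr hg
  left := by rw [hg (left_mem_Icc.2 h.lt.le), h.left]
  right := by rw [hg (right_mem_Icc.2 h.lt.le), h.right]
  hasDeriv x hx := (h.hasDeriv x hx).congr_of_eventuallyEq <| by
    filter_upwards [isOpen_Ioo.mem_nhds hx] with y hy using hg (Ioo_subset_Icc_self hy)
  pos := h.pos
  koebe_left := h.koebe_left.congr fun x hx => by simp only [hg (Ioo_subset_Icc_self hx)]
  koebe_right := h.koebe_right.congr fun x hx => by simp only [hg (Ioo_subset_Icc_self hx)]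

theorem affine {p q : ℝ} (h : p < q) :
    KoebeBranch p q (fun x => (x - p) / (q - p)) (fun _ => 1 / (q - p)) where
  lt := h
  cont := by fun_prop
  left := by simp
  right := div_self (sub_pos.2 h).ne'
  hasDeriv x _ := ((hasDerivAt_id x).sub_const p).div_const (q - p)
  pos _ _ := one_div_pos.2 (sub_pos.2 h)
  koebe_left := by
    have hqp := (sub_pos.2 h).ne'
    refine (monotoneOn_const (c := 1 / (q - p))).congr fun x hx => ?_
    have := (sub_pos.2 hx.1).ne'
    field_simp
  koebe_right := by
    have hqp := (sub_pos.2 h).ne'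
    refine (antitoneOn_const (c := 1 / (q - p))).congr fun x hx => ?_
    have := (sub_pos.2 hx.2).ne'
    rw [show 1 - (x - p) / (q - p) = (q - x) / (q - p) by field_simp; ring]
    field_simp

/-- By the chain rule the Koebe quotient of the composition is the quotient of `φ` at `f x` times
that of `f`; the factor (f x)², or (1 - f x)², cancels. Both factors are nonnegative and monotone in
the same sense. -/
theorem comp {φ φ' : ℝ → ℝ} (hφ : KoebeBranch 0 1 φ φ') (h : KoebeBranch p q f f') :
    KoebeBranch p q (fun x => φ (f x)) (fun x => φ' (f x) * f' x) where
  lt := h.lt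
  cont := hφ.cont.comp h.cont h.mapsTo_Icc
  left := by simp only [h.left, hφ.left]
  right := by simp only [h.right, hφ.right]
  hasDeriv x hx := (hφ.hasDeriv _ (h.mapsTo hx)).comp x (h.hasDeriv x hx)
  pos x hx := mul_pos (hφ.pos _ (h.mapsTo hx)) (h.pos x hx)
  koebe_left := by
    have h1 := hφ.koebe_left.comp (h.strictMonoOn.monotoneOn.mono Ioo_subset_Icc_self) h.mapsTo
    have h2 := h1.mul h.koebe_left
      (fun x hx => div_nonneg (sq_nonneg _)
        (mul_nonneg (hφ.pos _ (h.mapsTo hx)).le (sq_nonneg _)))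
      (fun x hx => div_nonneg (sq_nonneg _) (mul_nonneg (h.pos _ hx).le (sq_nonneg _)))
    refine h2.congr fun x hx => ?_
    have a1 := hφ.pos _ (h.mapsTo hx)
    have a2 := h.pos x hx
    have a3 := (h.mapsTo hx).1
    have a4 := sub_pos.2 hx.1
    simp only [Pi.mul_apply, Function.comp, sub_zero]
    field_simp
  koebe_right := by
    have h1 := hφ.koebe_right.comp_MonotoneOn
      (h.strictMonoOn.monotoneOn.mono Ioo_subset_Icc_self) h.mapsTo
    have h2 := antitoneOn_mul_of_nonneg h1 h.koebe_right
      (fun x hx => div_nonneg (sq_nonneg _)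
        (mul_nonneg (hφ.pos _ (h.mapsTo hx)).le (sq_nonneg _)))
      (fun x hx => div_nonneg (sq_nonneg _) (mul_nonneg (h.pos _ hx).le (sq_nonneg _)))
    refine h2.congr fun x hx => ?_
    have a1 := hφ.pos _ (h.mapsTo hx)
    have a2 := h.pos x hx
    have a3 := sub_pos.2 (h.mapsTo hx).2
    have a4 := sub_pos.2 hx.2
    simp only [Pi.mul_apply, Function.comp]
    field_simp

theorem reflect (h : KoebeBranch 0 1 f f') :
    KoebeBranch 0 1 (fun x => 1 - f (1 - x)) (fun x => f' (1 - x)) where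
  lt := one_pos
  cont := by
    refine continuousOn_const.sub (h.cont.comp (by fun_prop) fun x hx => ?_)
    exact ⟨by linarith [hx.2], by linarith [hx.1]⟩
  left := by simp [h.right]
  right := by simp [h.left]
  hasDeriv x hx := by
    have hx' : 1 - x ∈ Ioo (0 : ℝ) 1 := ⟨by linarith [hx.2], by linarith [hx.1]⟩
    have h1 := ((h.hasDeriv _ hx').comp x ((hasDerivAt_id x).const_sub 1)).const_sub 1
    exact h1.congr_deriv (by ring)
  pos x hx := h.pos _ ⟨by linarith [hx.2], by linarith [hx.1]⟩
  koebe_left x hx y hy hxy := by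
    have := h.koebe_right (a := 1 - y) (b := 1 - x) ⟨by linarith [hy.2], by linarith [hy.1]⟩
      ⟨by linarith [hx.2], by linarith [hx.1]⟩ (by linarith)
    simpa using this
  koebe_right x hx y hy hxy := by
    have := h.koebe_left (a := 1 - y) (b := 1 - x) ⟨by linarith [hy.2], by linarith [hy.1]⟩
      ⟨by linarith [hx.2], by linarith [hx.1]⟩ (by linarith)
    simpa using this

end KoebeBranch

/-- The left quotient is t^(α-1)/α. The right one needs the Schwarzian argument, applied after the
reflection z = 1 - t: the critical point, where the derivative vanishes, goes to z = 1, which the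
half-open interval of `monotoneOn_sq_div_of_schwarzian` leaves out. -/
theorem koebeBranch_rpow {α : ℝ} (hα : 1 < α) :
    KoebeBranch 0 1 (fun t => t ^ α) (fun t => α * t ^ (α - 1)) where
  lt := one_pos
  cont := (Real.continuous_rpow_const (by linarith)).continuousOn
  left := Real.zero_rpow (by linarith)
  right := Real.one_rpow _
  hasDeriv x hx := Real.hasDerivAt_rpow_const (Or.inl hx.1.ne')
  pos x hx := mul_pos (by linarith) (Real.rpow_pos_of_pos hx.1 _)
  koebe_left := by
    have h : MonotoneOn (fun t : ℝ => t ^ (α - 1) / α) (Ioo 0 1) := fun x hx y hy hxy =>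
      div_le_div_of_nonneg_right (Real.rpow_le_rpow hx.1.le hxy (by linarith)) (by linarith)
    refine h.congr fun x hx => ?_
    have hx0 := hx.1
    have h1 : x ^ α = x ^ (α - 1) * x := by
      rw [← Real.rpow_add_one hx0.ne']; ring_nf
    have := Real.rpow_pos_of_pos hx0 (α - 1)
    simp only [h1, sub_zero]
    field_simp
  koebe_right := by
    have key : MonotoneOn (fun z : ℝ => (1 - (1 - z) ^ α) ^ 2 / (α * (1 - z) ^ (α - 1) * z ^ 2))
        (Ioo 0 1) := by
      have hne : ∀ z ∈ Ico (0 : ℝ) 1, 0 < 1 - z := fun z hz => sub_pos.2 hz.2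
      have hder : ∀ (β : ℝ), ∀ z ∈ Ioo (0 : ℝ) 1,
          HasDerivAt (fun z : ℝ => (1 - z) ^ β) (-(β * (1 - z) ^ (β - 1))) z := fun β z hz => by
        have h1 := (Real.hasDerivAt_rpow_const (p := β)
          (Or.inl (hne z ⟨hz.1.le, hz.2⟩).ne')).comp z ((hasDerivAt_id z).const_sub 1)
        exact h1.congr_deriv (by ring)
      have hcont : ∀ β : ℝ, ContinuousOn (fun z : ℝ => (1 - z) ^ β) (Ico 0 1) := fun β =>
        ContinuousOn.rpow_const (by fun_prop) fun z hz => Or.inl (hne z hz).ne'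
      refine monotoneOn_sq_div_of_schwarzian (Q := fun z => -((α - 1) / (1 - z)))
        (R := fun z => -((α - 1) / (1 - z) ^ 2)) (by simp)
        (continuousOn_const.sub (hcont α)) (continuousOn_const.mul (hcont _))
        (continuousOn_const.div (by fun_prop) fun z hz => (hne z hz).ne').neg
        (fun z hz => ?_) (fun z hz => ?_) (fun z hz => ?_) (fun z hz => ?_) (fun z hz => ?_)
      · exact ((hder α z hz).const_sub 1).congr_deriv (by ring)
      · have hz1 := hne z ⟨hz.1.le, hz.2⟩
        refine ((hder (α - 1) z hz).const_mul α).congr_deriv ?_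
        rw [Real.rpow_sub_one hz1.ne' (α - 1)]
        field_simp
      · have hz1 := hne z ⟨hz.1.le, hz.2⟩
        have h1 := (((hasDerivAt_id z).const_sub 1).fun_inv hz1.ne').const_mul (-(α - 1))
        refine (h1.congr_deriv ?_).congr_of_eventuallyEq ?_
        · simp only [id]
          ring
        · filter_upwards with y
          simp only [id]
          ring
      · exact mul_pos (by linarith) (Real.rpow_pos_of_pos (hne z hz) _)
      · have hz1 := hne z ⟨hz.1.le, hz.2⟩
        have h1 : 0 ≤ (α - 1) / (1 - z) ^ 2 := div_nonneg (by linarith) (sq_nonneg _)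
        have h2 := sq_nonneg (-((α - 1) / (1 - z)))
        linarith
    intro x hx y hy hxy
    have := key (a := 1 - y) (b := 1 - x) ⟨by linarith [hy.2], by linarith [hy.1]⟩
      ⟨by linarith [hx.2], by linarith [hx.1]⟩ (by linarith)
    simpa using this

theorem one_sub_mem_Ioo {x : ℝ} (hx : x ∈ Ioo (0 : ℝ) 1) : 1 - x ∈ Ioo (0 : ℝ) 1 :=
  ⟨by linarith [hx.2], by linarith [hx.1]⟩

theorem koebeBranch_of_schwarzian {φ d Q R : ℝ → ℝ} (hφ0 : φ 0 = 0) (hφ1 : φ 1 = 1)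
    (hφc : ContinuousOn φ (Icc 0 1)) (hdc : ContinuousOn d (Icc 0 1))
    (hQc : ContinuousOn Q (Icc 0 1))
    (hφ : ∀ z ∈ Ioo (0 : ℝ) 1, HasDerivAt φ (d z) z)
    (hd : ∀ z ∈ Ioo (0 : ℝ) 1, HasDerivAt d (d z * Q z) z)
    (hQ : ∀ z ∈ Ioo (0 : ℝ) 1, HasDerivAt Q (R z) z)
    (hpos : ∀ z ∈ Icc (0 : ℝ) 1, 0 < d z)
    (hR : ∀ z ∈ Ioo (0 : ℝ) 1, R z ≤ Q z ^ 2 / 2) :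
    KoebeBranch 0 1 φ d where
  lt := one_pos
  cont := hφc
  left := hφ0
  right := hφ1
  hasDeriv := hφ
  pos z hz := hpos z (Ioo_subset_Icc_self hz)
  koebe_left := by
    have hs : Ico (0 : ℝ) 1 ⊆ Icc 0 1 := Ico_subset_Icc_self
    simpa using monotoneOn_sq_div_of_schwarzian hφ0 (hφc.mono hs) (hdc.mono hs) (hQc.mono hs)
      hφ hd hQ (fun z hz => hpos z (hs hz)) hR
  koebe_right := by
    have hm : MapsTo (fun z : ℝ => 1 - z) (Ico 0 1) (Icc 0 1) := fun z hz =>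
      ⟨by linarith [hz.2], by linarith [hz.1]⟩
    have hsub : ContinuousOn (fun z : ℝ => 1 - z) (Ico 0 1) := by fun_prop
    have hder : ∀ {g g' : ℝ → ℝ}, (∀ z ∈ Ioo (0 : ℝ) 1, HasDerivAt g (g' z) z) →
        ∀ z ∈ Ioo (0 : ℝ) 1, HasDerivAt (fun z => g (1 - z)) (-g' (1 - z)) z :=
      fun hg z hz => ((hg _ (one_sub_mem_Ioo hz)).comp z
        ((hasDerivAt_id z).const_sub 1)).congr_deriv (by ring)
    have key := monotoneOn_sq_div_of_schwarzian (φ := fun z => 1 - φ (1 - z))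
      (d := fun z => d (1 - z)) (Q := fun z => -Q (1 - z)) (R := fun z => R (1 - z))
      (by simp [hφ1]) (continuousOn_const.sub (hφc.comp hsub hm)) (hdc.comp hsub hm)
      (hQc.comp hsub hm).neg
      (fun z hz => ((hder hφ z hz).const_sub 1).congr_deriv (by ring))
      (fun z hz => (hder hd z hz).congr_deriv (by ring))
      (fun z hz => (hder hQ z hz).fun_neg.congr_deriv (by ring))
      (fun z hz => hpos _ (hm hz))
      (fun z hz => by simpa using hR _ (one_sub_mem_Ioo hz))
    intro x hx y hy hxy
    simpa using key (one_sub_mem_Ioo hy) (one_sub_mem_Ioo hx) (by linarith)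

/-! ### The diffeomorphic parts as Koebe branches. -/

namespace IsDiffeoPart

variable {φ : ℝ → ℝ}

theorem hasDerivWithinAt (h : IsDiffeoPart φ) {k : ℕ} (hk : k < 3) {x : ℝ}
    (hx : x ∈ Icc (0 : ℝ) 1) :
    HasDerivWithinAt (iteratedDerivWithin k φ (Icc 0 1))
      (iteratedDerivWithin (k + 1) φ (Icc 0 1) x) (Icc 0 1) x := by
  have h1 := h.contDiffOn.differentiableOn_iteratedDerivWithin (m := k) (mod_cast hk)
    (uniqueDiffOn_Icc one_pos)
  rw [iteratedDerivWithin_succ]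
  exact (h1 x hx).hasDerivWithinAt

theorem hasDerivAt (h : IsDiffeoPart φ) {k : ℕ} (hk : k < 3) {x : ℝ}
    (hx : x ∈ Ioo (0 : ℝ) 1) :
    HasDerivAt (iteratedDerivWithin k φ (Icc 0 1))
      (iteratedDerivWithin (k + 1) φ (Icc 0 1) x) x :=
  (h.hasDerivWithinAt hk (Ioo_subset_Icc_self hx)).hasDerivAt (Icc_mem_nhds hx.1 hx.2)

theorem hasDerivAt_self (h : IsDiffeoPart φ) {x : ℝ} (hx : x ∈ Ioo (0 : ℝ) 1) :
    HasDerivAt φ (iteratedDerivWithin 1 φ (Icc 0 1) x) x := by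
  simpa using h.hasDerivAt (k := 0) (by norm_num) hx

theorem continuousOn_iteratedDerivWithin (h : IsDiffeoPart φ) {k : ℕ} (hk : k < 3) :
    ContinuousOn (iteratedDerivWithin k φ (Icc 0 1)) (Icc 0 1) :=
  fun _ hx => (h.hasDerivWithinAt hk hx).continuousWithinAt

theorem strictMonoOn (h : IsDiffeoPart φ) : StrictMonoOn φ (Icc 0 1) :=
  strictMonoOn_of_hasDerivAt_pos (convex_Icc 0 1) h.contDiffOn.continuousOn
    (by rw [interior_Icc]; exact fun x hx => h.hasDerivAt_self hx)
    (by rw [interior_Icc]; exact fun x hx => h.deriv_pos x (Ioo_subset_Icc_self hx))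

theorem map_zero (h : IsDiffeoPart φ) : φ 0 = 0 := by
  have h0 : (0 : ℝ) ∈ Icc (0 : ℝ) 1 := left_mem_Icc.2 zero_le_one
  obtain ⟨x, hx, hx0⟩ := h.bijOn.surjOn h0
  exact le_antisymm (hx0 ▸ h.strictMonoOn.monotoneOn h0 hx hx.1) (h.bijOn.mapsTo h0).1

theorem map_one (h : IsDiffeoPart φ) : φ 1 = 1 := by
  have h1 : (1 : ℝ) ∈ Icc (0 : ℝ) 1 := right_mem_Icc.2 zero_le_one
  obtain ⟨x, hx, hx1⟩ := h.bijOn.surjOn h1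
  have h2 := h.strictMonoOn.monotoneOn hx h1 hx.2
  exact le_antisymm (h.bijOn.mapsTo h1).2 (hx1.symm.le.trans h2)

theorem koebeBranch (h : IsDiffeoPart φ) :
    KoebeBranch 0 1 φ (iteratedDerivWithin 1 φ (Icc 0 1)) := by
  set d1 := iteratedDerivWithin 1 φ (Icc 0 1) with hd1
  set d2 := iteratedDerivWithin 2 φ (Icc 0 1) with hd2
  set d3 := iteratedDerivWithin 3 φ (Icc 0 1) with hd3
  have hne : ∀ x ∈ Icc (0 : ℝ) 1, d1 x ≠ 0 := fun x hx => (h.deriv_pos x hx).ne'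
  have hsub : Ioo (0 : ℝ) 1 ⊆ Icc 0 1 := Ioo_subset_Icc_self
  refine koebeBranch_of_schwarzian (Q := fun x => d2 x / d1 x)
    (R := fun x => d3 x / d1 x - (d2 x / d1 x) ^ 2) h.map_zero h.map_one
    h.contDiffOn.continuousOn (h.continuousOn_iteratedDerivWithin (by norm_num))
    ((h.continuousOn_iteratedDerivWithin (by norm_num)).div
      (h.continuousOn_iteratedDerivWithin (by norm_num)) hne)
    (fun z hz => h.hasDerivAt_self hz) (fun z hz => ?_) (fun z hz => ?_) h.deriv_pos
    (fun z hz => ?_)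
  · refine (h.hasDerivAt (k := 1) (by norm_num) hz).congr_deriv ?_
    have := hne z (hsub hz)
    simp only [← hd2]
    field_simp
  · have h1 := (h.hasDerivAt (k := 2) (by norm_num) hz).div
      (h.hasDerivAt (k := 1) (by norm_num) hz) (hne z (hsub hz))
    refine h1.congr_deriv ?_
    have := hne z (hsub hz)
    simp only [← hd2, ← hd1, ← hd3]
    field_simp
  · have := h.schwarzian_nonpos z (hsub hz)
    simp only [schwarzian, ← hd1, ← hd2, ← hd3] at this
    linarith

/-- The derivative is at least 1 - ε; integrate from 0 for the first bound and back from 1 for the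
second. -/
theorem mul_le_of_close (h : IsDiffeoPart φ) {ε : ℝ} (hε : C2CloseToId ε φ) {z : ℝ}
    (hz : z ∈ Icc (0 : ℝ) 1) : (1 - ε) * z ≤ φ z ∧ φ z ≤ 1 - (1 - ε) * (1 - z) := by
  have hm : MonotoneOn (fun z => φ z - (1 - ε) * z) (Icc 0 1) := by
    refine monotoneOn_of_hasDerivAt_nonneg (convex_Icc 0 1)
      (f' := fun z => iteratedDerivWithin 1 φ (Icc 0 1) z - (1 - ε)) ?_ ?_ ?_
    · exact h.contDiffOn.continuousOn.sub (by fun_prop)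
    · rw [interior_Icc]
      exact fun x hx => ((h.hasDerivAt_self hx).sub
        ((hasDerivAt_id x).const_mul (1 - ε))).congr_deriv (by ring)
    · rw [interior_Icc]
      intro x hx
      have := (abs_le.1 (hε x (Ioo_subset_Icc_self hx)).2.1).1
      linarith
  have h1 := hm (left_mem_Icc.2 zero_le_one) hz hz.1
  have h2 := hm hz (right_mem_Icc.2 zero_le_one) hz.2
  simp only [h.map_zero, h.map_one] at h1 h2
  constructor <;> linarith

end IsDiffeoPart

/-! ### Koebe densities, the Harnack inequality, and push-forward. -/

/-- Densities on `(0,1)` satisfying both one-sided Koebe (Harnack) inequalities. -/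
structure KoebeDensity (h : ℝ → ℝ) : Prop where
  nonneg : ∀ x ∈ Ioo (0 : ℝ) 1, 0 ≤ h x
  mono : MonotoneOn (fun x => x ^ 2 * h x) (Ioo 0 1)
  anti : AntitoneOn (fun x => (1 - x) ^ 2 * h x) (Ioo 0 1)

/-- Measures on `(0,1)` with a density satisfying both one-sided Koebe inequalities. -/
def KoebeMeasure (κ : Measure ℝ) : Prop :=
  ∃ h, KoebeDensity h ∧
    κ = (volume.restrict (Ioo 0 1)).withDensity fun x => ENNReal.ofReal (h x)

namespace KoebeDensity

variable {h k : ℝ → ℝ}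

theorem const {a : ℝ} (ha : 0 ≤ a) : KoebeDensity fun _ => a where
  nonneg _ _ := ha
  mono _ hx _ _ hxy := mul_le_mul_of_nonneg_right (pow_le_pow_left₀ hx.1.le hxy 2) ha
  anti _ _ _ hy hxy :=
    mul_le_mul_of_nonneg_right (pow_le_pow_left₀ (by linarith [hy.2]) (by linarith) 2) ha

theorem add (hh : KoebeDensity h) (hk : KoebeDensity k) : KoebeDensity fun x => h x + k x where
  nonneg x hx := add_nonneg (hh.nonneg x hx) (hk.nonneg x hx)
  mono := (hh.mono.add hk.mono).congr fun x _ => by simp only [mul_add]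
  anti := (hh.anti.add hk.anti).congr fun x _ => by simp only [mul_add]

theorem aemeasurable (hh : KoebeDensity h) : AEMeasurable h (volume.restrict (Ioo 0 1)) := by
  have h1 := aemeasurable_restrict_of_monotoneOn (μ := volume) measurableSet_Ioo hh.mono
  have h2 : AEMeasurable (fun x : ℝ => x⁻¹ ^ 2 * (x ^ 2 * h x)) (volume.restrict (Ioo 0 1)) :=
    (measurable_inv.pow_const 2).aemeasurable.mul h1
  refine h2.congr ((ae_restrict_mem measurableSet_Ioo).mono fun x hx => ?_)
  have := hx.1.ne'
  simp only
  field_simp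

/-- For y to the right of x compare through the increasing x²h, to the left through the decreasing
(1-x)²h. The weight at x is at least δ², the weight at y at most 1. -/
theorem harnack (hh : KoebeDensity h) {δ x y : ℝ} (hδ : 0 < δ) (hx : x ∈ Icc δ (1 - δ))
    (hy : y ∈ Ioo (0 : ℝ) 1) : δ ^ 2 * h x ≤ h y := by
  have hx' : x ∈ Ioo (0 : ℝ) 1 := ⟨hδ.trans_le hx.1, by linarith [hx.2]⟩
  have hx0 := hh.nonneg x hx'
  have hy0 := hh.nonneg y hy
  rcases le_total x y with hxy | hxy
  · calc δ ^ 2 * h x ≤ x ^ 2 * h x :=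
          mul_le_mul_of_nonneg_right (pow_le_pow_left₀ hδ.le hx.1 2) hx0
      _ ≤ y ^ 2 * h y := hh.mono hx' hy hxy
      _ ≤ 1 * h y := mul_le_mul_of_nonneg_right (pow_le_one₀ hy.1.le hy.2.le) hy0
      _ = h y := one_mul _
  · calc δ ^ 2 * h x ≤ (1 - x) ^ 2 * h x :=
          mul_le_mul_of_nonneg_right (pow_le_pow_left₀ hδ.le (by linarith [hx.2]) 2) hx0
      _ ≤ (1 - y) ^ 2 * h y := hh.anti hy hx' hxy
      _ ≤ 1 * h y := mul_le_mul_of_nonneg_right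
          (pow_le_one₀ (by linarith [hy.2]) (by linarith [hy.1])) hy0
      _ = h y := one_mul _

end KoebeDensity

namespace KoebeMeasure

variable {κ κ' : Measure ℝ}

theorem volume_restrict : KoebeMeasure (volume.restrict (Ioo 0 1)) :=
  ⟨fun _ => 1, KoebeDensity.const zero_le_one, by simp⟩

theorem add (h : KoebeMeasure κ) (h' : KoebeMeasure κ') : KoebeMeasure (κ + κ') := by
  obtain ⟨h, hh, rfl⟩ := h
  obtain ⟨k, hk, rfl⟩ := h'
  refine ⟨_, hh.add hk, ?_⟩
  ext A hA
  have hm : AEMeasurable (fun x => ENNReal.ofReal (h x)) ((volume.restrict (Ioo 0 1)).restrict A) :=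
    hh.aemeasurable.ennreal_ofReal.restrict
  rw [Measure.add_apply, withDensity_apply _ hA, withDensity_apply _ hA, withDensity_apply _ hA,
    ← lintegral_add_left' hm]
  refine lintegral_congr_ae (ae_restrict_of_ae
    ((ae_restrict_mem measurableSet_Ioo).mono fun x hx => ?_))
  exact (ENNReal.ofReal_add (hh.nonneg x hx) (hk.nonneg x hx)).symm

theorem absolutelyContinuous (h : KoebeMeasure κ) : κ ≪ volume.restrict (Ioo 0 1) := by
  obtain ⟨h, hh, rfl⟩ := h
  exact withDensity_absolutelyContinuous _ _

theorem noAtoms (h : KoebeMeasure κ) (x : ℝ) : κ {x} = 0 :=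
  h.absolutelyContinuous (by simp)

theorem compl_Ioo (h : KoebeMeasure κ) : κ (Ioo 0 1)ᶜ = 0 :=
  h.absolutelyContinuous (by
    rw [Measure.restrict_apply measurableSet_Ioo.compl, compl_inter_self, measure_empty])

theorem withDensity_restrict_apply (h : ℝ → ℝ) {A : Set ℝ} (hA : MeasurableSet A) :
    (volume.restrict (Ioo 0 1)).withDensity (fun x => ENNReal.ofReal (h x)) A =
      ∫⁻ x in A ∩ Ioo 0 1, ENNReal.ofReal (h x) := by
  rw [withDensity_apply _ hA, Measure.restrict_restrict hA]

/-- Harnack integrated over y in (0,1), then over x in `A`. The companion `mul_volume_le` integrates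
over x in [δ,1-δ] with y in `A`. -/
theorem le_mul_volume (h : KoebeMeasure κ) {δ : ℝ} (hδ : 0 < δ) {A : Set ℝ}
    (hA : MeasurableSet A) (hAδ : A ⊆ Icc δ (1 - δ)) :
    ENNReal.ofReal (δ ^ 2) * κ A ≤ κ univ * volume A := by
  obtain ⟨h, hh, rfl⟩ := h
  have hsub : A ⊆ Ioo 0 1 := fun x hx => ⟨hδ.trans_le (hAδ hx).1, by linarith [(hAδ hx).2]⟩
  rw [withDensity_restrict_apply h hA, withDensity_restrict_apply h MeasurableSet.univ, univ_inter, inter_eq_self_of_subset_left hsub,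
    ← lintegral_const_mul' _ _ ENNReal.ofReal_ne_top, ← setLIntegral_const]
  refine setLIntegral_mono' hA fun x hx => ?_
  calc ENNReal.ofReal (δ ^ 2) * ENNReal.ofReal (h x)
      = ∫⁻ _ in Ioo (0 : ℝ) 1, ENNReal.ofReal (δ ^ 2) * ENNReal.ofReal (h x) := by simp
    _ ≤ ∫⁻ y in Ioo (0 : ℝ) 1, ENNReal.ofReal (h y) := by
        refine setLIntegral_mono' measurableSet_Ioo fun y hy => ?_
        rw [← ENNReal.ofReal_mul (sq_nonneg δ)]
        exact ENNReal.ofReal_le_ofReal (hh.harnack hδ (hAδ hx) hy)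

theorem mul_volume_le (h : KoebeMeasure κ) {δ : ℝ} (hδ : 0 < δ) {A : Set ℝ}
    (hA : MeasurableSet A) :
    ENNReal.ofReal (δ ^ 2) * κ (Icc δ (1 - δ)) * volume (A ∩ Ioo 0 1) ≤ κ A := by
  obtain ⟨h, hh, rfl⟩ := h
  have hsub : Icc δ (1 - δ) ⊆ Ioo 0 1 := fun x hx => ⟨hδ.trans_le hx.1, by linarith [hx.2]⟩
  rw [withDensity_restrict_apply h hA, withDensity_restrict_apply h measurableSet_Icc, inter_eq_self_of_subset_left hsub,
    ← setLIntegral_const]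
  refine setLIntegral_mono' (hA.inter measurableSet_Ioo) fun y hy => ?_
  rw [← lintegral_const_mul' _ _ ENNReal.ofReal_ne_top]
  calc ∫⁻ x in Icc δ (1 - δ), ENNReal.ofReal (δ ^ 2) * ENNReal.ofReal (h x)
      ≤ ∫⁻ _ in Icc δ (1 - δ), ENNReal.ofReal (h y) := by
        refine setLIntegral_mono' measurableSet_Icc fun x hx => ?_
        rw [← ENNReal.ofReal_mul (sq_nonneg δ)]
        exact ENNReal.ofReal_le_ofReal (hh.harnack hδ hx hy.2)
    _ ≤ ENNReal.ofReal (h y) * 1 := by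
        rw [setLIntegral_const]
        gcongr
        rw [Real.volume_Icc]
        exact ENNReal.ofReal_le_one.2 (by linarith)
    _ = ENNReal.ofReal (h y) := mul_one _

/-- The push-forward of a Koebe measure under a Koebe branch is a Koebe measure. -/
theorem map_branch (h : KoebeMeasure κ) {p q : ℝ} {f f' T : ℝ → ℝ} (hb : KoebeBranch p q f f')
    (hp : 0 ≤ p) (hq : q ≤ 1) (hT : Measurable T) (hTf : EqOn T f (Ioo p q)) :
    KoebeMeasure ((κ.restrict (Ioo p q)).map T) := by
  obtain ⟨h, hh, rfl⟩ := h
  have hinj : InjOn f (Ioo p q) := hb.strictMonoOn.injOn.mono Ioo_subset_Icc_self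
  have hsub : Ioo p q ⊆ Ioo 0 1 := Ioo_subset_Ioo hp hq
  let g : ℝ → ℝ := Function.invFunOn f (Ioo p q)
  have hgmem : ∀ y ∈ Ioo (0 : ℝ) 1, g y ∈ Ioo p q := fun y hy =>
    Function.invFunOn_mem (hb.exists_eq_Ioo hy)
  have hfg : ∀ y ∈ Ioo (0 : ℝ) 1, f (g y) = y := fun y hy =>
    Function.invFunOn_eq (hb.exists_eq_Ioo hy)
  have hgf : ∀ x ∈ Ioo p q, g (f x) = x := fun x hx => hinj.leftInvOn_invFunOn hx
  have hgmono : MonotoneOn g (Ioo 0 1) := fun x hx y hy hxy => by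
    by_contra hlt
    have := hb.strictMonoOn (Ioo_subset_Icc_self (hgmem y hy)) (Ioo_subset_Icc_self (hgmem x hx))
      (not_le.1 hlt)
    rw [hfg x hx, hfg y hy] at this
    exact absurd hxy (not_le.2 this)
  refine ⟨fun y => h (g y) / f' (g y), ⟨fun y hy => ?_, ?_, ?_⟩, ?_⟩
  · exact div_nonneg (hh.nonneg _ (hsub (hgmem y hy))) (hb.pos _ (hgmem y hy)).le
  -- With y = f x, the weighted density y²h(x)/f'(x) is the product of x²h(x), of f²/(f'(x-p)²) and
  -- of ((x-p)/x)². All three increase in x, the last because p ≥ 0. The other end is symmetric and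
  -- uses q ≤ 1.
  · have m1 : MonotoneOn (fun x : ℝ => ((x - p) / x) ^ 2) (Ioo p q) := fun x hx y hy hxy => by
      have hx0 : 0 < x := hp.trans_lt hx.1
      have hy0 : 0 < y := hp.trans_lt hy.1
      refine pow_le_pow_left₀ (div_nonneg (sub_pos.2 hx.1).le hx0.le) ?_ 2
      rw [div_le_div_iff₀ hx0 hy0]
      nlinarith
    have m2 := ((hh.mono.mono hsub).mul hb.koebe_left
      (fun x hx => mul_nonneg (sq_nonneg _) (hh.nonneg _ (hsub hx)))
      (fun x hx => div_nonneg (sq_nonneg _) (mul_nonneg (hb.pos _ hx).le (sq_nonneg _))))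
    have m3 := m2.mul m1
      (fun x hx => mul_nonneg (mul_nonneg (sq_nonneg _) (hh.nonneg _ (hsub hx)))
        (div_nonneg (sq_nonneg _) (mul_nonneg (hb.pos _ hx).le (sq_nonneg _))))
      (fun x _ => sq_nonneg _)
    refine (m3.comp hgmono hgmem).congr fun y hy => ?_
    have a1 := hb.pos _ (hgmem y hy)
    have a2 := sub_pos.2 (hgmem y hy).1
    have a3 : 0 < g y := hp.trans_lt (hgmem y hy).1
    simp only [Function.comp, Pi.mul_apply, hfg y hy]
    field_simp
  · have m1 : AntitoneOn (fun x : ℝ => ((q - x) / (1 - x)) ^ 2) (Ioo p q) := fun x hx y hy hxy => by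
      have hx0 : 0 < 1 - x := by linarith [hx.2]
      have hy0 : 0 < 1 - y := by linarith [hy.2]
      refine pow_le_pow_left₀ (div_nonneg (sub_pos.2 hy.2).le hy0.le) ?_ 2
      rw [div_le_div_iff₀ hy0 hx0]
      nlinarith
    have m2 := (antitoneOn_mul_of_nonneg (hh.anti.mono hsub) hb.koebe_right
      (fun x hx => mul_nonneg (sq_nonneg _) (hh.nonneg _ (hsub hx)))
      (fun x hx => div_nonneg (sq_nonneg _) (mul_nonneg (hb.pos _ hx).le (sq_nonneg _))))
    have m3 := antitoneOn_mul_of_nonneg m2 m1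
      (fun x hx => mul_nonneg (mul_nonneg (sq_nonneg _) (hh.nonneg _ (hsub hx)))
        (div_nonneg (sq_nonneg _) (mul_nonneg (hb.pos _ hx).le (sq_nonneg _))))
      (fun x _ => sq_nonneg _)
    refine (m3.comp_MonotoneOn hgmono hgmem).congr fun y hy => ?_
    have a1 := hb.pos _ (hgmem y hy)
    have a2 := sub_pos.2 (hgmem y hy).2
    have a3 : 0 < 1 - g y := by linarith [(hgmem y hy).2]
    simp only [Function.comp, Pi.mul_apply, hfg y hy]
    field_simp
  · ext A hA
    have hS : MeasurableSet (T ⁻¹' A ∩ Ioo p q) := (hT hA).inter measurableSet_Ioo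
    have himg : A ∩ Ioo 0 1 = f '' (T ⁻¹' A ∩ Ioo p q) := by
      ext y
      constructor
      · rintro ⟨hyA, hy⟩
        refine ⟨g y, ⟨?_, hgmem y hy⟩, hfg y hy⟩
        rw [mem_preimage, hTf (hgmem y hy), hfg y hy]
        exact hyA
      · rintro ⟨x, ⟨hxA, hx⟩, rfl⟩
        rw [mem_preimage, hTf hx] at hxA
        exact ⟨hxA, hb.mapsTo hx⟩
    rw [Measure.map_apply hT hA, Measure.restrict_apply (hT hA), withDensity_apply _ hS,
      Measure.restrict_restrict hS, withDensity_apply _ hA, Measure.restrict_restrict hA, himg,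
      lintegral_image_eq_lintegral_abs_deriv_mul hS
        (fun x hx => (hb.hasDeriv x hx.2).hasDerivWithinAt) (hinj.mono inter_subset_right),
      inter_eq_self_of_subset_left (inter_subset_right.trans hsub)]
    refine setLIntegral_congr_fun hS fun x hx => ?_
    have := hb.pos x hx.2
    simp only [hgf x hx.2]
    rw [← ENNReal.ofReal_mul (abs_nonneg _), abs_of_pos this]
    congr 1
    field_simp

end KoebeMeasure

/-! ### Systems with two full branches. -/

/-- A measurable map of the line which has two full Koebe branches on `(0,c)` and `(c,1)`. -/
structure FullSystem (T : ℝ → ℝ) (c : ℝ) (f₀ f₀' f₁ f₁' : ℝ → ℝ) : Prop where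
  meas : Measurable T
  branch₀ : KoebeBranch 0 c f₀ f₀'
  branch₁ : KoebeBranch c 1 f₁ f₁'
  eq₀ : EqOn T f₀ (Ioo 0 c)
  eq₁ : EqOn T f₁ (Ioo c 1)

namespace FullSystem

variable {T : ℝ → ℝ} {c : ℝ} {f₀ f₀' f₁ f₁' : ℝ → ℝ} {κ : Measure ℝ}

theorem measure_compl_union (c : ℝ)
    (h : κ ≪ volume.restrict (Ioo 0 1)) : κ (Ioo 0 c ∪ Ioo c 1)ᶜ = 0 := by
  refine h ?_
  rw [Measure.restrict_apply (measurableSet_Ioo.union measurableSet_Ioo).compl]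
  refine measure_mono_null (t := {c}) (fun x hx => ?_) (by simp)
  by_contra hxc
  rcases lt_or_gt_of_ne hxc with h1 | h1
  · exact hx.1 (Or.inl ⟨hx.2.1, h1⟩)
  · exact hx.1 (Or.inr ⟨h1, hx.2.2⟩)

theorem eq_restrict_add (c : ℝ)
    (h : κ ≪ volume.restrict (Ioo 0 1)) :
    κ = κ.restrict (Ioo 0 c) + κ.restrict (Ioo c 1) := by
  have hd : Disjoint (Ioo (0 : ℝ) c) (Ioo c 1) :=
    disjoint_left.2 fun x hx hx' => absurd hx.2 (not_lt.2 hx'.1.le)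
  rw [← Measure.restrict_union hd measurableSet_Ioo]
  exact (Measure.restrict_eq_self_of_ae_mem (measure_compl_union c h)).symm

theorem koebeMeasure_map₀ (S : FullSystem T c f₀ f₀' f₁ f₁') (h : KoebeMeasure κ) :
    KoebeMeasure ((κ.restrict (Ioo 0 c)).map T) :=
  h.map_branch S.branch₀ le_rfl S.branch₁.lt.le S.meas S.eq₀

theorem koebeMeasure_map₁ (S : FullSystem T c f₀ f₀' f₁ f₁') (h : KoebeMeasure κ) :
    KoebeMeasure ((κ.restrict (Ioo c 1)).map T) :=
  h.map_branch S.branch₁ S.branch₀.lt.le le_rfl S.meas S.eq₁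

theorem koebeMeasure_map (S : FullSystem T c f₀ f₀' f₁ f₁') (h : KoebeMeasure κ) :
    KoebeMeasure (κ.map T) := by
  rw [eq_restrict_add c h.absolutelyContinuous, Measure.map_add _ _ S.meas]
  exact (S.koebeMeasure_map₀ h).add (S.koebeMeasure_map₁ h)

theorem map_iterate_succ (S : FullSystem T c f₀ f₀' f₁ f₁') (κ : Measure ℝ) (n : ℕ) :
    κ.map T^[n + 1] = (κ.map T^[n]).map T := by
  rw [Measure.map_map S.meas (S.meas.iterate n), Function.iterate_succ']

theorem koebeMeasure_iterate (S : FullSystem T c f₀ f₀' f₁ f₁') (h : KoebeMeasure κ) (n : ℕ) :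
    KoebeMeasure (κ.map T^[n]) := by
  induction n with
  | zero => simpa using h
  | succ n ih =>
    rw [S.map_iterate_succ]
    exact S.koebeMeasure_map ih

theorem map_iterate_univ (S : FullSystem T c f₀ f₀' f₁ f₁') (κ : Measure ℝ) (n : ℕ) :
    (κ.map T^[n]) univ = κ univ := by
  rw [Measure.map_apply (S.meas.iterate n) MeasurableSet.univ, preimage_univ]

end FullSystem

/-! ### Uniform control of mass near the fixed points. -/

/-- Quantitative expansion at the fixed points and Hölder bounds at the critical point. -/
structure Quantified (θ s C β δ₁ c : ℝ) (f₀ f₁ : ℝ → ℝ) : Prop where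
  expand₀ : ∀ x ∈ Ioo 0 c, f₀ x ≤ s → x ≤ θ * f₀ x
  expand₁ : ∀ x ∈ Ioo c 1, 1 - f₁ x ≤ s → 1 - x ≤ θ * (1 - f₁ x)
  holder₀ : ∀ x ∈ Ioo 0 c, c - x ≤ C * (1 - f₀ x) ^ β
  holder₁ : ∀ x ∈ Ioo c 1, x - c ≤ C * f₁ x ^ β
  le_crit : δ₁ ≤ c - C * s ^ β
  crit_le : c + C * s ^ β ≤ 1 - δ₁

/-- Unrolling the recursion gives a geometric series with ratio θ^β. The subtracted term is its
missing remainder, which makes the induction close exactly; it is dropped later. -/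
theorem le_of_contracting_recursion {m : ℕ → ℝ → ℝ} {θ s β B : ℝ} (hθ : θ ∈ Ioo (0 : ℝ) 1)
    (hβ : 0 < β)
    (h : ∀ n t, 0 < t → t ≤ s → m (n + 1) t ≤ m n (θ * t) + B * t ^ β) (n : ℕ) :
    ∀ t, 0 < t → t ≤ s → m n t ≤ m 0 (θ ^ n * t) + B / (1 - θ ^ β) * t ^ β -
      B / (1 - θ ^ β) * (θ ^ n * t) ^ β := by
  have hr : 0 < 1 - θ ^ β := sub_pos.2 (Real.rpow_lt_one hθ.1.le hθ.2 hβ)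
  induction n with
  | zero => intro t _ _; simp
  | succ n ih =>
    intro t ht hts
    have h1 := h n t ht hts
    have h2 := ih (θ * t) (mul_pos hθ.1 ht) (by nlinarith [hθ.2])
    have h3 : (θ * t) ^ β = θ ^ β * t ^ β := Real.mul_rpow hθ.1.le ht.le
    rw [h3, show θ ^ n * (θ * t) = θ ^ (n + 1) * t by ring] at h2
    have h4 : B / (1 - θ ^ β) * (θ ^ β * t ^ β) + B * t ^ β = B / (1 - θ ^ β) * t ^ β := by
      field_simp
      ring
    linarith

namespace FullSystem

variable {T : ℝ → ℝ} {c : ℝ} {f₀ f₀' f₁ f₁' : ℝ → ℝ} {κ : Measure ℝ} {θ s C β δ₁ : ℝ}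

theorem real_le_mul_volume [IsFiniteMeasure κ] (h : KoebeMeasure κ) {δ : ℝ} (hδ : 0 < δ)
    {A : Set ℝ} (hA : MeasurableSet A) (hAδ : A ⊆ Icc δ (1 - δ)) :
    κ.real A ≤ κ.real univ / δ ^ 2 * volume.real A := by
  have h1 := h.le_mul_volume hδ hA hAδ
  have hfin : volume A ≠ ⊤ := measure_ne_top_of_subset hAδ (by simp)
  have h2 := ENNReal.toReal_mono (ENNReal.mul_ne_top (measure_ne_top κ univ) hfin) h1
  rw [ENNReal.toReal_mul, ENNReal.toReal_mul, ENNReal.toReal_ofReal (sq_nonneg δ)] at h2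
  rw [div_mul_eq_mul_div, le_div_iff₀ (pow_pos hδ 2), mul_comm]
  exact h2

/-- Points sent below t lie either near 0, contracted by θ, or just right of c, within C t^β. The
second set stays in [δ₁,1-δ₁], so Harnack bounds its mass by its length. -/
theorem map_real_Iic_le [IsFiniteMeasure κ] (S : FullSystem T c f₀ f₀' f₁ f₁')
    (Q : Quantified θ s C β δ₁ c f₀ f₁) (hθ : 0 < θ) (hC : 0 < C) (hβ : 0 < β) (hδ₁ : 0 < δ₁)
    (h : KoebeMeasure κ) {t : ℝ} (ht : 0 < t) (hts : t ≤ s) :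
    (κ.map T).real (Iic t) ≤ κ.real (Iic (θ * t)) + κ.real univ / δ₁ ^ 2 * C * t ^ β := by
  have hpow : t ^ β ≤ s ^ β := Real.rpow_le_rpow ht.le hts hβ.le
  have hpow0 : 0 ≤ t ^ β := Real.rpow_nonneg ht.le _
  have hsub : T ⁻¹' Iic t ⊆ (Iic (θ * t) ∪ Icc c (c + C * t ^ β)) ∪ (Ioo 0 c ∪ Ioo c 1)ᶜ := by
    intro x hx
    by_cases hxm : x ∈ Ioo 0 c ∪ Ioo c 1
    · left
      rcases hxm with hx0 | hx1
      · left
        rw [mem_preimage, S.eq₀ hx0] at hx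
        exact (Q.expand₀ x hx0 (le_trans hx hts)).trans (mul_le_mul_of_nonneg_left hx hθ.le)
      · right
        rw [mem_preimage, S.eq₁ hx1] at hx
        have h1 := Q.holder₁ x hx1
        have h2 : f₁ x ^ β ≤ t ^ β := Real.rpow_le_rpow (S.branch₁.mapsTo hx1).1.le hx hβ.le
        exact ⟨hx1.1.le, by nlinarith⟩
    · exact Or.inr hxm
  rw [map_measureReal_apply S.meas measurableSet_Iic]
  have hIcc : Icc c (c + C * t ^ β) ⊆ Icc δ₁ (1 - δ₁) := by
    refine Icc_subset_Icc ?_ ?_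
    · nlinarith [Q.le_crit]
    · nlinarith [Q.crit_le]
  have hvol : volume.real (Icc c (c + C * t ^ β)) = C * t ^ β := by
    rw [Real.volume_real_Icc_of_le (by nlinarith)]; ring
  calc κ.real (T ⁻¹' Iic t)
      ≤ κ.real ((Iic (θ * t) ∪ Icc c (c + C * t ^ β)) ∪ (Ioo 0 c ∪ Ioo c 1)ᶜ) :=
        measureReal_mono hsub
    _ ≤ κ.real (Iic (θ * t) ∪ Icc c (c + C * t ^ β)) + κ.real (Ioo 0 c ∪ Ioo c 1)ᶜ :=
        measureReal_union_le _ _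
    _ = κ.real (Iic (θ * t) ∪ Icc c (c + C * t ^ β)) := by
        rw [measureReal_def κ (_ᶜ), measure_compl_union c h.absolutelyContinuous]; simp
    _ ≤ κ.real (Iic (θ * t)) + κ.real (Icc c (c + C * t ^ β)) := measureReal_union_le _ _
    _ ≤ _ := by
        have := real_le_mul_volume h hδ₁ measurableSet_Icc hIcc
        rw [hvol] at this
        linarith

theorem map_real_Ici_le [IsFiniteMeasure κ] (S : FullSystem T c f₀ f₀' f₁ f₁')
    (Q : Quantified θ s C β δ₁ c f₀ f₁) (hθ : 0 < θ) (hC : 0 < C) (hβ : 0 < β) (hδ₁ : 0 < δ₁)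
    (h : KoebeMeasure κ) {t : ℝ} (ht : 0 < t) (hts : t ≤ s) :
    (κ.map T).real (Ici (1 - t)) ≤
      κ.real (Ici (1 - θ * t)) + κ.real univ / δ₁ ^ 2 * C * t ^ β := by
  have hpow : t ^ β ≤ s ^ β := Real.rpow_le_rpow ht.le hts hβ.le
  have hpow0 : 0 ≤ t ^ β := Real.rpow_nonneg ht.le _
  have hsub : T ⁻¹' Ici (1 - t) ⊆
      (Ici (1 - θ * t) ∪ Icc (c - C * t ^ β) c) ∪ (Ioo 0 c ∪ Ioo c 1)ᶜ := by
    intro x hx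
    by_cases hxm : x ∈ Ioo 0 c ∪ Ioo c 1
    · left
      rcases hxm with hx0 | hx1
      · right
        rw [mem_preimage, S.eq₀ hx0, mem_Ici] at hx
        have h1 := Q.holder₀ x hx0
        have h2 : (1 - f₀ x) ^ β ≤ t ^ β :=
          Real.rpow_le_rpow (sub_pos.2 (S.branch₀.mapsTo hx0).2).le (by linarith) hβ.le
        exact ⟨by nlinarith, hx0.2.le⟩
      · left
        rw [mem_preimage, S.eq₁ hx1, mem_Ici] at hx
        have h1 := Q.expand₁ x hx1 (by linarith)
        rw [mem_Ici]
        nlinarith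
    · exact Or.inr hxm
  rw [map_measureReal_apply S.meas measurableSet_Ici]
  have hIcc : Icc (c - C * t ^ β) c ⊆ Icc δ₁ (1 - δ₁) := by
    refine Icc_subset_Icc ?_ ?_
    · nlinarith [Q.le_crit]
    · nlinarith [Q.crit_le]
  have hvol : volume.real (Icc (c - C * t ^ β) c) = C * t ^ β := by
    rw [Real.volume_real_Icc_of_le (by nlinarith)]; ring
  calc κ.real (T ⁻¹' Ici (1 - t))
      ≤ κ.real ((Ici (1 - θ * t) ∪ Icc (c - C * t ^ β) c) ∪ (Ioo 0 c ∪ Ioo c 1)ᶜ) :=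
        measureReal_mono hsub
    _ ≤ κ.real (Ici (1 - θ * t) ∪ Icc (c - C * t ^ β) c) + κ.real (Ioo 0 c ∪ Ioo c 1)ᶜ :=
        measureReal_union_le _ _
    _ = κ.real (Ici (1 - θ * t) ∪ Icc (c - C * t ^ β) c) := by
        rw [measureReal_def κ (_ᶜ), measure_compl_union c h.absolutelyContinuous]; simp
    _ ≤ κ.real (Ici (1 - θ * t)) + κ.real (Icc (c - C * t ^ β) c) := measureReal_union_le _ _
    _ ≤ _ := by
        have := real_le_mul_volume h hδ₁ measurableSet_Icc hIcc
        rw [hvol] at this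
        linarith

/-- Uniform bound for the mass that iterates put near the fixed points. -/
theorem tail_le [IsFiniteMeasure κ] (S : FullSystem T c f₀ f₀' f₁ f₁')
    (Q : Quantified θ s C β δ₁ c f₀ f₁) (hθ : θ ∈ Ioo (0 : ℝ) 1) (hC : 0 < C) (hβ : 0 < β)
    (hδ₁ : 0 < δ₁) (h : KoebeMeasure κ) (n : ℕ) {t : ℝ} (ht : 0 < t) (hts : t ≤ s) :
    (κ.map T^[n]).real (Iic t) + (κ.map T^[n]).real (Ici (1 - t)) ≤
      κ.real (Iic (θ ^ n * t)) + κ.real (Ici (1 - θ ^ n * t)) +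
        2 * (κ.real univ * (C / δ₁ ^ 2 / (1 - θ ^ β)) * t ^ β) := by
  have hr : 0 < 1 - θ ^ β := sub_pos.2 (Real.rpow_lt_one hθ.1.le hθ.2 hβ)
  have hB : 0 ≤ κ.real univ / δ₁ ^ 2 * C / (1 - θ ^ β) := by positivity
  have huniv : ∀ n, (κ.map T^[n]).real univ = κ.real univ := fun n => by
    rw [measureReal_def, measureReal_def, S.map_iterate_univ]
  have h1 := le_of_contracting_recursion (m := fun n t => (κ.map T^[n]).real (Iic t))
    (s := s) (B := κ.real univ / δ₁ ^ 2 * C) hθ hβ (fun n t ht hts => by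
      have := S.map_real_Iic_le Q hθ.1 hC hβ hδ₁ (S.koebeMeasure_iterate h n) ht hts
      rw [huniv, ← S.map_iterate_succ] at this
      exact this) n t ht hts
  have h2 := le_of_contracting_recursion (m := fun n t => (κ.map T^[n]).real (Ici (1 - t)))
    (s := s) (B := κ.real univ / δ₁ ^ 2 * C) hθ hβ (fun n t ht hts => by
      have := S.map_real_Ici_le Q hθ.1 hC hβ hδ₁ (S.koebeMeasure_iterate h n) ht hts
      rw [huniv, ← S.map_iterate_succ] at this
      exact this) n t ht hts
  simp only [Function.iterate_zero, Measure.map_id] at h1 h2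
  have h3 : 0 ≤ κ.real univ / δ₁ ^ 2 * C / (1 - θ ^ β) * (θ ^ n * t) ^ β :=
    mul_nonneg hB (Real.rpow_nonneg (mul_pos (pow_pos hθ.1 n) ht).le _)
  have h4 : κ.real univ / δ₁ ^ 2 * C / (1 - θ ^ β) * t ^ β =
      κ.real univ * (C / δ₁ ^ 2 / (1 - θ ^ β)) * t ^ β := by ring
  linarith

end FullSystem

theorem tendsto_tail_const (D : ℝ) {β : ℝ} (hβ : 0 < β) :
    Tendsto (fun t : ℝ => 2 * t + 2 * (D * t ^ β)) (𝓝[>] 0) (𝓝 0) := by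
  have h : ContinuousAt (fun t : ℝ => 2 * t + 2 * (D * t ^ β)) 0 :=
    (continuousAt_const.mul continuousAt_id).add (continuousAt_const.mul
      (continuousAt_const.mul (Real.continuousAt_rpow_const 0 β (Or.inr hβ.le))))
  have h0 : 2 * (0 : ℝ) + 2 * (D * (0 : ℝ) ^ β) = 0 := by simp [Real.zero_rpow hβ.ne']
  have := h.tendsto.mono_left (nhdsWithin_le_nhds (s := Ioi 0))
  rwa [h0] at this

theorem exists_tail_const_le (D : ℝ) {β s ε : ℝ} (hβ : 0 < β) (hs : 0 < s) (hε : 0 < ε) :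
    ∃ t, 0 < t ∧ t ≤ s ∧ 2 * t + 2 * (D * t ^ β) ≤ ε := by
  have h1 := (tendsto_tail_const D hβ).eventually (eventually_le_nhds hε)
  have h2 : ∀ᶠ t : ℝ in 𝓝[>] 0, t ≤ s :=
    (eventually_le_nhds hs).filter_mono nhdsWithin_le_nhds
  obtain ⟨t, ht, hts, ht0⟩ := (h1.and (h2.and self_mem_nhdsWithin)).exists
  exact ⟨t, ht0, hts, ht⟩

namespace FullSystem

variable {T : ℝ → ℝ} {c : ℝ} {f₀ f₀' f₁ f₁' : ℝ → ℝ} {κ : Measure ℝ} {θ s C β δ₁ δ : ℝ}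

theorem real_sub_tail_le [IsFiniteMeasure κ] (A : Set ℝ) (t : ℝ) :
    κ.real A ≤ κ.real (A ∩ Icc t (1 - t)) + (κ.real (Iic t) + κ.real (Ici (1 - t))) := by
  have hsub : A ⊆ (A ∩ Icc t (1 - t)) ∪ (Iic t ∪ Ici (1 - t)) := fun x hx => by
    rcases le_total x t with h | h
    · exact Or.inr (Or.inl h)
    · rcases le_total x (1 - t) with h' | h'
      · exact Or.inl ⟨hx, h, h'⟩
      · exact Or.inr (Or.inr h')
  calc κ.real A ≤ κ.real ((A ∩ Icc t (1 - t)) ∪ (Iic t ∪ Ici (1 - t))) := measureReal_mono hsub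
    _ ≤ κ.real (A ∩ Icc t (1 - t)) + κ.real (Iic t ∪ Ici (1 - t)) := measureReal_union_le _ _
    _ ≤ _ := by gcongr; exact measureReal_union_le _ _

theorem lebesgue_tail_le {r : ℝ} (hr : 0 ≤ r) :
    (volume.restrict (Ioo (0 : ℝ) 1)).real (Iic r) +
      (volume.restrict (Ioo (0 : ℝ) 1)).real (Ici (1 - r)) ≤ 2 * r := by
  have h1 : (volume.restrict (Ioo (0 : ℝ) 1)).real (Iic r) ≤ r := by
    rw [measureReal_restrict_apply measurableSet_Iic]
    calc volume.real (Iic r ∩ Ioo 0 1) ≤ volume.real (Icc 0 r) :=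
          measureReal_mono (fun x hx => ⟨hx.2.1.le, hx.1⟩) (by simp)
      _ = r := by rw [Real.volume_real_Icc_of_le hr, sub_zero]
  have h2 : (volume.restrict (Ioo (0 : ℝ) 1)).real (Ici (1 - r)) ≤ r := by
    rw [measureReal_restrict_apply measurableSet_Ici]
    calc volume.real (Ici (1 - r) ∩ Ioo 0 1) ≤ volume.real (Icc (1 - r) 1) :=
          measureReal_mono (fun x hx => ⟨hx.1, hx.2.2.le⟩) (by simp)
      _ = r := by rw [Real.volume_real_Icc_of_le (by linarith)]; ring
  linarith

theorem lebesgue_univ : (volume.restrict (Ioo (0 : ℝ) 1)).real univ = 1 := by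
  simp

theorem lebesgue_iterate_tail_le (S : FullSystem T c f₀ f₀' f₁ f₁')
    (Q : Quantified θ s C β δ₁ c f₀ f₁) (hθ : θ ∈ Ioo (0 : ℝ) 1) (hC : 0 < C) (hβ : 0 < β)
    (hδ₁ : 0 < δ₁) (n : ℕ) {t : ℝ} (ht : 0 < t) (hts : t ≤ s) :
    ((volume.restrict (Ioo 0 1)).map T^[n]).real (Iic t) +
      ((volume.restrict (Ioo 0 1)).map T^[n]).real (Ici (1 - t)) ≤
      2 * t + 2 * (C / δ₁ ^ 2 / (1 - θ ^ β) * t ^ β) := by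
  have h1 := S.tail_le Q hθ hC hβ hδ₁ KoebeMeasure.volume_restrict n ht hts
  have hn : θ ^ n * t ≤ t := mul_le_of_le_one_left ht.le (pow_le_one₀ hθ.1.le hθ.2.le)
  have h2 := lebesgue_tail_le (mul_pos (pow_pos hθ.1 n) ht).le
  rw [lebesgue_univ, one_mul] at h1
  linarith

theorem half_le_lebesgue_iterate (S : FullSystem T c f₀ f₀' f₁ f₁')
    (Q : Quantified θ s C β δ₁ c f₀ f₁) (hθ : θ ∈ Ioo (0 : ℝ) 1) (hC : 0 < C) (hβ : 0 < β)
    (hδ₁ : 0 < δ₁) (hδ : 0 < δ) (hδs : δ ≤ s)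
    (hδc : 2 * δ + 2 * (C / δ₁ ^ 2 / (1 - θ ^ β) * δ ^ β) ≤ 1 / 4) (n : ℕ) :
    1 / 2 ≤ ((volume.restrict (Ioo 0 1)).map T^[n]).real (Icc δ (1 - δ)) := by
  have h1 := S.lebesgue_iterate_tail_le Q hθ hC hβ hδ₁ n hδ hδs
  have h2 := real_sub_tail_le (κ := (volume.restrict (Ioo 0 1)).map T^[n]) univ δ
  rw [univ_inter, measureReal_def _ univ, S.map_iterate_univ, ← measureReal_def,
    lebesgue_univ] at h2
  linarith

/-- A general Koebe measure may concentrate near 0 and 1, but after n steps its initial tails matter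
only at scale θ^n δ, and these tend to zero. Once each is at most 1/8 of the total, the lost mass is
at most 1/8 + 1/8 + 1/4 of it. -/
theorem exists_half_le_iterate [IsFiniteMeasure κ] (S : FullSystem T c f₀ f₀' f₁ f₁')
    (Q : Quantified θ s C β δ₁ c f₀ f₁) (hθ : θ ∈ Ioo (0 : ℝ) 1) (hC : 0 < C) (hβ : 0 < β)
    (hδ₁ : 0 < δ₁) (hδ : 0 < δ) (hδs : δ ≤ s)
    (hδc : 2 * δ + 2 * (C / δ₁ ^ 2 / (1 - θ ^ β) * δ ^ β) ≤ 1 / 4) (h : KoebeMeasure κ) :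
    ∃ n, κ.real univ / 2 ≤ (κ.map T^[n]).real (Icc δ (1 - δ)) := by
  rcases (measureReal_nonneg (μ := κ) (s := univ)).eq_or_lt with h0 | hpos
  · exact ⟨0, by rw [← h0, zero_div]; exact measureReal_nonneg⟩
  have hlim : Tendsto (fun n : ℕ => θ ^ n * δ) atTop (𝓝 0) := by
    simpa using (tendsto_pow_atTop_nhds_zero_of_lt_one hθ.1.le hθ.2).mul_const δ
  have hanti : Antitone fun n : ℕ => θ ^ n * δ := fun m n hmn =>
    mul_le_mul_of_nonneg_right (pow_le_pow_of_le_one hθ.1.le hθ.2.le hmn) hδ.le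
  have hA : Antitone fun n : ℕ => Iic (θ ^ n * δ) ∪ Ici (1 - θ ^ n * δ) := fun m n hmn =>
    union_subset_union (Iic_subset_Iic.2 (hanti hmn))
      (Ici_subset_Ici.2 (sub_le_sub_left (hanti hmn) 1))
  have hinter : ⋂ n : ℕ, (Iic (θ ^ n * δ) ∪ Ici (1 - θ ^ n * δ)) ⊆ (Ioo 0 1)ᶜ := by
    intro x hx hx01
    rw [mem_iInter] at hx
    have h1 := hlim.eventually (eventually_lt_nhds hx01.1)
    have h2 := hlim.eventually (eventually_lt_nhds (sub_pos.2 hx01.2))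
    obtain ⟨n, hn1, hn2⟩ := (h1.and h2).exists
    rcases hx n with h | h
    · exact absurd h (not_le.2 hn1)
    · rw [mem_Ici] at h; linarith
  have ht := tendsto_measure_iInter_atTop (μ := κ)
    (fun n => (measurableSet_Iic.union measurableSet_Ici).nullMeasurableSet) hA
    ⟨0, measure_ne_top _ _⟩
  rw [measure_mono_null hinter h.compl_Ioo] at ht
  have ht' := (ENNReal.tendsto_toReal ENNReal.zero_ne_top).comp ht
  rw [ENNReal.toReal_zero] at ht'
  obtain ⟨n, hn⟩ := (ht'.eventually (eventually_le_nhds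
    (show 0 < κ.real univ / 8 by linarith))).exists
  refine ⟨n, ?_⟩
  have b1 : κ.real (Iic (θ ^ n * δ)) ≤ κ.real univ / 8 :=
    (measureReal_mono subset_union_left).trans hn
  have b2 : κ.real (Ici (1 - θ ^ n * δ)) ≤ κ.real univ / 8 :=
    (measureReal_mono subset_union_right).trans hn
  have h1 := S.tail_le Q hθ hC hβ hδ₁ h n hδ hδs
  have h2 := real_sub_tail_le (κ := κ.map T^[n]) univ δ
  rw [univ_inter, measureReal_def _ univ, S.map_iterate_univ, ← measureReal_def] at h2
  have h3 : κ.real univ * (2 * (C / δ₁ ^ 2 / (1 - θ ^ β) * δ ^ β)) ≤ κ.real univ * (1 / 4) :=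
    mul_le_mul_of_nonneg_left (by linarith) hpos.le
  linarith

/-- The iterates of Lebesgue measure are uniformly absolutely continuous. -/
theorem uniform_absolutelyContinuous (S : FullSystem T c f₀ f₀' f₁ f₁')
    (Q : Quantified θ s C β δ₁ c f₀ f₁) (hθ : θ ∈ Ioo (0 : ℝ) 1) (hC : 0 < C) (hβ : 0 < β)
    (hδ₁ : 0 < δ₁) (hs : 0 < s) {ε : ℝ} (hε : 0 < ε) :
    ∃ η, 0 < η ∧ ∀ A, MeasurableSet A → (volume.restrict (Ioo (0 : ℝ) 1)).real A ≤ η →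
      ∀ n, ((volume.restrict (Ioo 0 1)).map T^[n]).real A ≤ ε := by
  -- The tails outside [t,1-t] account for ε/2. Inside, Harnack bounds the density of every iterate
  -- by 1/t², so Lebesgue measure t²ε/2 accounts for the rest.
  obtain ⟨t, ht, hts, htε⟩ := exists_tail_const_le (C / δ₁ ^ 2 / (1 - θ ^ β)) hβ hs (half_pos hε)
  refine ⟨t ^ 2 * (ε / 2), by positivity, fun A hA hAη n => ?_⟩
  have h1 := S.lebesgue_iterate_tail_le Q hθ hC hβ hδ₁ n ht hts
  have h2 := real_sub_tail_le (κ := (volume.restrict (Ioo 0 1)).map T^[n]) A t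
  have h3 := real_le_mul_volume (S.koebeMeasure_iterate KoebeMeasure.volume_restrict n) ht
    (hA.inter measurableSet_Icc) inter_subset_right
  rw [measureReal_def _ univ, S.map_iterate_univ, ← measureReal_def, lebesgue_univ] at h3
  have h4 : volume.real (A ∩ Icc t (1 - t)) ≤ t ^ 2 * (ε / 2) := by
    refine le_trans ?_ hAη
    rw [measureReal_restrict_apply hA]
    exact measureReal_mono
      (fun x hx => ⟨hx.1, ht.trans_le hx.2.1, by linarith [hx.2.2]⟩)
      (measure_ne_top_of_subset (inter_subset_right (s := A)) (by simp))
  have h5 : 1 / t ^ 2 * volume.real (A ∩ Icc t (1 - t)) ≤ ε / 2 := by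
    rw [div_mul_eq_mul_div, one_mul, div_le_iff₀ (pow_pos ht 2)]
    linarith
  linarith

theorem lower_bound [IsFiniteMeasure κ] (h : KoebeMeasure κ) (hδ : 0 < δ) {A : Set ℝ}
    (hA : MeasurableSet A) :
    δ ^ 2 * κ.real (Icc δ (1 - δ)) * (volume.restrict (Ioo 0 1)).real A ≤ κ.real A := by
  have h1 := ENNReal.toReal_mono (measure_ne_top κ A) (h.mul_volume_le hδ hA)
  rw [ENNReal.toReal_mul, ENNReal.toReal_mul, ENNReal.toReal_ofReal (sq_nonneg δ)] at h1
  rwa [measureReal_restrict_apply hA]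

end FullSystem

/-! ### Existence of an invariant measure, and epsilon-delta absolute continuity. -/

/-- An invariant probability measure obtained as a limit of averages of push-forwards of `lam`
along an ultrafilter, when these push-forwards are uniformly absolutely continuous. -/
theorem exists_invariant_of_uniform_absolutelyContinuous {X : Type*} [MeasurableSpace X]
    {T : X → X} (hT : Measurable T)
    (lam ρ : Measure X) [IsProbabilityMeasure lam] [IsFiniteMeasure ρ]
    (hac : ∀ ε > (0 : ℝ), ∃ η > (0 : ℝ), ∀ A, MeasurableSet A → ρ.real A ≤ η →
      ∀ n : ℕ, (lam.map T^[n]).real A ≤ ε) :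
    ∃ μ : Measure X, IsProbabilityMeasure μ ∧ MeasurePreserving T μ μ ∧ μ ≪ ρ ∧
      ∀ (a : ℝ) (A : Set X), MeasurableSet A → (∀ n : ℕ, a ≤ (lam.map T^[n]).real A) →
        a ≤ μ.real A := by
  have hprob : ∀ n : ℕ, IsProbabilityMeasure (lam.map T^[n]) := fun n =>
    Measure.isProbabilityMeasure_map (hT.iterate n).aemeasurable
  let a : ℕ → Set X → ℝ := fun n A =>
    (∑ k ∈ Finset.range (n + 1), (lam.map T^[k]).real A) / (n + 1 : ℝ)
  have hn0 : ∀ n : ℕ, (0 : ℝ) < n + 1 := fun n => by positivity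
  have ha_ge : ∀ (b : ℝ) (A : Set X), (∀ n : ℕ, b ≤ (lam.map T^[n]).real A) → ∀ n, b ≤ a n A := by
    intro b A hb n
    rw [le_div_iff₀ (hn0 n)]
    have := Finset.card_nsmul_le_sum (Finset.range (n + 1)) (fun k => (lam.map T^[k]).real A) b
      fun k _ => hb k
    rw [Finset.card_range, nsmul_eq_mul] at this
    push_cast at this
    linarith
  have ha_le : ∀ (b : ℝ) (A : Set X), (∀ n : ℕ, (lam.map T^[n]).real A ≤ b) → ∀ n, a n A ≤ b := by
    intro b A hb n
    rw [div_le_iff₀ (hn0 n)]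
    have := Finset.sum_le_card_nsmul (Finset.range (n + 1)) (fun k => (lam.map T^[k]).real A) b
      fun k _ => hb k
    rw [Finset.card_range, nsmul_eq_mul] at this
    push_cast at this
    linarith
  have hlim : ∀ A : Set X, ∃ l, Tendsto (fun n => a n A) (hyperfilter ℕ : Filter ℕ) (𝓝 l) := by
    intro A
    have hmem : ∀ n, a n A ∈ Icc (0 : ℝ) 1 := fun n =>
      ⟨ha_ge 0 A (fun _ => measureReal_nonneg) n, ha_le 1 A (fun _ => measureReal_le_one) n⟩
    obtain ⟨l, _, hl⟩ := (isCompact_Icc (a := (0 : ℝ)) (b := 1)).ultrafilter_le_nhds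
      ((hyperfilter ℕ).map fun n => a n A) (by
        rw [Ultrafilter.coe_map, le_principal_iff, mem_map]
        exact univ_mem' hmem)
    exact ⟨l, hl⟩
  choose L hL using hlim
  have hL_ge : ∀ (b : ℝ) (A : Set X), (∀ n : ℕ, b ≤ (lam.map T^[n]).real A) → b ≤ L A :=
    fun b A hb => ge_of_tendsto' (hL A) (ha_ge b A hb)
  have hL_le : ∀ (b : ℝ) (A : Set X), (∀ n : ℕ, (lam.map T^[n]).real A ≤ b) → L A ≤ b :=
    fun b A hb => le_of_tendsto' (hL A) (ha_le b A hb)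
  have hL0 : ∀ A, 0 ≤ L A := fun A => hL_ge 0 A fun _ => measureReal_nonneg
  have hLadd : ∀ A B, Disjoint A B → MeasurableSet B → L (A ∪ B) = L A + L B := by
    intro A B hAB hB
    refine tendsto_nhds_unique (hL (A ∪ B)) (((hL A).add (hL B)).congr fun n => ?_)
    simp only [a]
    rw [← add_div, ← Finset.sum_add_distrib]
    congr 1
    exact Finset.sum_congr rfl fun k _ => (measureReal_union hAB hB).symm
  have hLempty : L ∅ = 0 := le_antisymm (hL_le 0 ∅ fun _ => by simp) (hL0 ∅)
  have hLinv : ∀ A, MeasurableSet A → L (T ⁻¹' A) = L A := by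
    intro A hA
    -- The averages over `T ⁻¹' A` and `A` differ by this telescoped boundary term.
    have hz : Tendsto (fun n : ℕ => ((lam.map T^[n + 1]).real A - lam.real A) / (n + 1 : ℝ))
        (hyperfilter ℕ : Filter ℕ) (𝓝 0) := by
      refine Tendsto.mono_left ?_ (Nat.hyperfilter_le_atTop)
      have h1 : Tendsto (fun n : ℕ => 1 / ((n : ℝ) + 1)) atTop (𝓝 0) :=
        tendsto_one_div_add_atTop_nhds_zero_nat
      refine squeeze_zero_norm (fun n => ?_) h1
      rw [norm_div, Real.norm_eq_abs, Real.norm_of_nonneg (hn0 n).le]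
      refine div_le_div_of_nonneg_right ?_ (hn0 n).le
      have b1 : (lam.map T^[n + 1]).real A ≤ 1 := measureReal_le_one
      have b2 : lam.real A ≤ 1 := measureReal_le_one
      have b3 : 0 ≤ (lam.map T^[n + 1]).real A := measureReal_nonneg
      have b4 : 0 ≤ lam.real A := measureReal_nonneg
      rw [abs_le]
      constructor <;> linarith
    have h2 := (hL A).add hz
    rw [add_zero] at h2
    refine tendsto_nhds_unique (hL (T ⁻¹' A)) (h2.congr fun n => ?_)
    simp only [a]
    rw [← add_div]
    congr 1
    have h3 : ∀ k, (lam.map T^[k]).real (T ⁻¹' A) = (lam.map T^[k + 1]).real A := fun k => by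
      rw [← map_measureReal_apply hT hA, Measure.map_map hT (hT.iterate k),
        Function.iterate_succ']
    simp only [h3]
    have h4 := Finset.sum_range_succ' (fun k => (lam.map T^[k]).real A) (n + 1)
    have h5 := Finset.sum_range_succ (fun k => (lam.map T^[k]).real A) (n + 1)
    simp only [Function.iterate_zero, Measure.map_id] at h4
    linarith
  have hLsmall : ∀ ε > (0 : ℝ), ∃ η > (0 : ℝ), ∀ A, MeasurableSet A → ρ.real A ≤ η → L A ≤ ε := by
    intro ε hε
    obtain ⟨η, hη, h⟩ := hac ε hε
    exact ⟨η, hη, fun A hA hAη => hL_le ε A (h A hA hAη)⟩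
  -- An ultrafilter limit is only finitely additive. Countable additivity follows because the tails
  -- of a disjoint union have ρ-measure tending to zero, and `L` is small on sets of small
  -- ρ-measure.
  have hsum : ∀ f : ℕ → Set X, (∀ i, MeasurableSet (f i)) → Pairwise (Function.onFun Disjoint f) →
      HasSum (fun i => L (f i)) (L (⋃ i, f i)) := by
    intro f hf hd
    have hfin : ∀ n : ℕ, L (⋃ i, f i) =
        ∑ i ∈ Finset.range n, L (f i) + L (⋃ i, f (i + n)) := by
      intro n
      induction n with
      | zero => simp
      | succ n ih =>
        rw [ih, Finset.sum_range_succ, add_assoc]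
        congr 1
        have hu : (⋃ i, f (i + n)) = f n ∪ ⋃ i, f (i + (n + 1)) := by
          ext x
          simp only [mem_iUnion, mem_union]
          constructor
          · rintro ⟨i, hi⟩
            rcases i with _ | i
            · left; simpa using hi
            · right; exact ⟨i, by convert hi using 2; ring⟩
          · rintro (hi | ⟨i, hi⟩)
            · exact ⟨0, by simpa using hi⟩
            · exact ⟨i + 1, by convert hi using 2; ring⟩
        rw [hu]
        refine hLadd _ _ ?_ (MeasurableSet.iUnion fun i => hf _)
        rw [disjoint_iUnion_right]
        exact fun i => hd (by omega)
    rw [hasSum_iff_tendsto_nat_of_nonneg (fun i => hL0 _)]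
    have htail : Tendsto (fun n => L (⋃ i, f (i + n))) atTop (𝓝 0) := by
      have hanti : Antitone fun n => ⋃ i, f (i + n) := fun m n hmn x hx => by
        obtain ⟨i, hi⟩ := mem_iUnion.1 hx
        exact mem_iUnion.2 ⟨i + (n - m), by convert hi using 2; omega⟩
      have hempty : ⋂ n, ⋃ i, f (i + n) = ∅ := by
        rw [eq_empty_iff_forall_notMem]
        intro x hx
        rw [mem_iInter] at hx
        obtain ⟨i, hi⟩ := mem_iUnion.1 (hx 0)
        obtain ⟨j, hj⟩ := mem_iUnion.1 (hx (i + 1))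
        exact (disjoint_left.1 (hd (show i + 0 ≠ j + (i + 1) by omega)) hi) hj
      have hρ := tendsto_measure_iInter_atTop (μ := ρ)
        (fun n => (MeasurableSet.iUnion fun i => hf (i + n)).nullMeasurableSet) hanti
        ⟨0, measure_ne_top _ _⟩
      rw [hempty, measure_empty] at hρ
      have hρ' := (ENNReal.tendsto_toReal ENNReal.zero_ne_top).comp hρ
      rw [ENNReal.toReal_zero] at hρ'
      rw [Metric.tendsto_atTop]
      intro ε hε
      obtain ⟨η, hη, hs⟩ := hLsmall (ε / 2) (half_pos hε)
      obtain ⟨N, hN⟩ := eventually_atTop.1 (hρ'.eventually (eventually_le_nhds hη))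
      refine ⟨N, fun n hn => ?_⟩
      have := hs _ (MeasurableSet.iUnion fun i => hf (i + n)) (hN n hn)
      rw [Real.dist_eq, sub_zero, abs_of_nonneg (hL0 _)]
      linarith
    have h6 := (tendsto_const_nhds (x := L (⋃ i, f i))).sub htail
    rw [sub_zero] at h6
    exact h6.congr fun n => by rw [hfin n]; ring
  let μ : Measure X := Measure.ofMeasurable (fun A _ => ENNReal.ofReal (L A)) (by simp [hLempty])
    fun f hf hd => by
      rw [← (hsum f hf hd).tsum_eq]
      exact ENNReal.ofReal_tsum_of_nonneg (fun i => hL0 _) (hsum f hf hd).summable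
  have hμ : ∀ A, MeasurableSet A → μ A = ENNReal.ofReal (L A) := fun A hA =>
    Measure.ofMeasurable_apply A hA
  have hμr : ∀ A, MeasurableSet A → μ.real A = L A := fun A hA => by
    rw [measureReal_def, hμ A hA, ENNReal.toReal_ofReal (hL0 A)]
  refine ⟨μ, ⟨?_⟩, ⟨hT, ?_⟩, ?_, fun b A hA hb => ?_⟩
  · rw [hμ _ MeasurableSet.univ, le_antisymm (hL_le 1 univ fun _ => measureReal_le_one)
      (hL_ge 1 univ fun _ => by simp), ENNReal.ofReal_one]
  · ext A hA
    rw [Measure.map_apply hT hA, hμ _ (hT hA), hμ _ hA, hLinv A hA]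
  · refine Measure.AbsolutelyContinuous.mk fun A hA hA0 => ?_
    rw [hμ A hA, ENNReal.ofReal_eq_zero]
    refine le_of_forall_pos_le_add fun ε hε => ?_
    obtain ⟨η, hη, hs⟩ := hLsmall ε hε
    rw [zero_add]
    exact hs A hA (by rw [measureReal_def, hA0]; exact hη.le)
  · rw [hμr A hA]
    exact hL_ge b A hb

theorem exists_real_lt_of_absolutelyContinuous {X : Type*} [MeasurableSpace X] {μ ν : Measure X}
    [IsFiniteMeasure μ] [IsFiniteMeasure ν] (h : μ ≪ ν) {ε : ℝ} (hε : 0 < ε) :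
    ∃ η > (0 : ℝ), ∀ A, MeasurableSet A → ν.real A < η → μ.real A < ε := by
  have hint : ∫⁻ x, μ.rnDeriv ν x ∂ν ≠ ⊤ := (Measure.lintegral_rnDeriv_lt_top μ ν).ne
  obtain ⟨δ, hδ, hs⟩ := exists_pos_setLIntegral_lt_of_measure_lt hint
    (ENNReal.ofReal_pos.2 hε).ne'
  -- `δ` may be infinite, and then `toReal` would send it to zero.
  have hδ' : min δ 1 ≠ ⊤ := ne_top_of_le_ne_top ENNReal.one_ne_top (min_le_right _ _)
  refine ⟨(min δ 1).toReal, ENNReal.toReal_pos (lt_min hδ one_pos).ne' hδ', fun A _ hA => ?_⟩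
  have h1 : ν A < δ := ((ENNReal.toReal_lt_toReal (measure_ne_top _ _) hδ').1 hA).trans_le
    (min_le_left _ _)
  have h2 := hs A h1
  rw [Measure.setLIntegral_rnDeriv h] at h2
  rw [measureReal_def]
  exact (ENNReal.lt_ofReal_iff_toReal_lt (measure_ne_top _ _)).1 h2

/-! ### Cylinders and ergodicity. -/

theorem KoebeBranch.preimage_Ioo {p q : ℝ} {f f' T : ℝ → ℝ} (hb : KoebeBranch p q f f')
    (hTf : EqOn T f (Ioo p q)) {a b : ℝ} (ha : a ∈ Icc p q) (hb' : b ∈ Icc p q) :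
    T ⁻¹' Ioo (f a) (f b) ∩ Ioo p q = Ioo a b := by
  ext x
  constructor
  · rintro ⟨hx, hxm⟩
    rw [mem_preimage, hTf hxm] at hx
    have hx' := Ioo_subset_Icc_self hxm
    exact ⟨(hb.strictMonoOn.lt_iff_lt ha hx').1 hx.1, (hb.strictMonoOn.lt_iff_lt hx' hb').1 hx.2⟩
  · rintro hx
    have hxm : x ∈ Ioo p q := ⟨ha.1.trans_lt hx.1, hx.2.trans_le hb'.2⟩
    have hx' := Ioo_subset_Icc_self hxm
    refine ⟨?_, hxm⟩
    rw [mem_preimage, hTf hxm]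
    exact ⟨hb.strictMonoOn ha hx' hx.1, hb.strictMonoOn hx' hb' hx.2⟩

/-- Intervals which are mapped onto `(0,1)` by `m` iterates of a map with branches `f₀`, `f₁`. -/
inductive Cylinder (c : ℝ) (f₀ f₁ : ℝ → ℝ) : ℕ → ℝ → ℝ → Prop
  | zero : Cylinder c f₀ f₁ 0 0 1
  | left {m : ℕ} {a b : ℝ} (ha : a ∈ Icc 0 c) (hb : b ∈ Icc 0 c)
      (h : Cylinder c f₀ f₁ m (f₀ a) (f₀ b)) : Cylinder c f₀ f₁ (m + 1) a b
  | right {m : ℕ} {a b : ℝ} (ha : a ∈ Icc c 1) (hb : b ∈ Icc c 1)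
      (h : Cylinder c f₀ f₁ m (f₁ a) (f₁ b)) : Cylinder c f₀ f₁ (m + 1) a b

/-- The end points of the cylinders of level `m`. -/
def cylinderEndpoints (c : ℝ) (f₀ f₁ : ℝ → ℝ) : ℕ → Set ℝ
  | 0 => {0, 1}
  | m + 1 => {x ∈ Icc 0 c | f₀ x ∈ cylinderEndpoints c f₀ f₁ m} ∪
      {x ∈ Icc c 1 | f₁ x ∈ cylinderEndpoints c f₀ f₁ m}

theorem Cylinder.mem_endpoints {c : ℝ} {f₀ f₁ : ℝ → ℝ} {m : ℕ} {a b : ℝ}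
    (h : Cylinder c f₀ f₁ m a b) :
    a ∈ cylinderEndpoints c f₀ f₁ m ∧ b ∈ cylinderEndpoints c f₀ f₁ m := by
  induction h with
  | zero => exact ⟨Or.inl rfl, Or.inr rfl⟩
  | left ha hb _ ih => exact ⟨Or.inl ⟨ha, ih.1⟩, Or.inl ⟨hb, ih.2⟩⟩
  | right ha hb _ ih => exact ⟨Or.inr ⟨ha, ih.1⟩, Or.inr ⟨hb, ih.2⟩⟩

namespace FullSystem

variable {T : ℝ → ℝ} {c : ℝ} {f₀ f₀' f₁ f₁' : ℝ → ℝ} {κ μ : Measure ℝ} {η₀ : ℝ}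

theorem exists_cylinder (S : FullSystem T c f₀ f₀' f₁ f₁') (m : ℕ) :
    ∀ t ∈ Icc (0 : ℝ) 1, ∃ a b, Cylinder c f₀ f₁ m a b ∧ t ∈ Icc a b := by
  have step : ∀ {p q : ℝ} {f f' : ℝ → ℝ} {t a b : ℝ}, KoebeBranch p q f f' → t ∈ Icc p q →
      f t ∈ Icc a b → a ∈ Icc (0 : ℝ) 1 → b ∈ Icc (0 : ℝ) 1 →
      ∃ a' b', a' ∈ Icc p q ∧ b' ∈ Icc p q ∧ f a' = a ∧ f b' = b ∧ t ∈ Icc a' b' := by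
    intro p q f f' t a b hb ht hft ha hb'
    obtain ⟨a', ha', rfl⟩ := hb.exists_eq ha
    obtain ⟨b', hb'', rfl⟩ := hb.exists_eq hb'
    exact ⟨a', b', ha', hb'', rfl, rfl, (hb.strictMonoOn.le_iff_le ha' ht).1 hft.1,
      (hb.strictMonoOn.le_iff_le ht hb'').1 hft.2⟩
  have hmem : ∀ {m : ℕ} {a b : ℝ}, Cylinder c f₀ f₁ m a b →
      a ∈ Icc (0 : ℝ) 1 ∧ b ∈ Icc (0 : ℝ) 1 := fun h => by
    have h0 : (0 : ℝ) ∈ Icc (0 : ℝ) 1 := left_mem_Icc.2 zero_le_one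
    have h1 : (1 : ℝ) ∈ Icc (0 : ℝ) 1 := right_mem_Icc.2 zero_le_one
    have hs0 : Icc 0 c ⊆ Icc 0 1 := Icc_subset_Icc_right S.branch₁.lt.le
    have hs1 : Icc c 1 ⊆ Icc 0 1 := Icc_subset_Icc_left S.branch₀.lt.le
    cases h with
    | zero => exact ⟨h0, h1⟩
    | left ha hb _ => exact ⟨hs0 ha, hs0 hb⟩
    | right ha hb _ => exact ⟨hs1 ha, hs1 hb⟩
  induction m with
  | zero => exact fun t ht => ⟨0, 1, .zero, ht⟩
  | succ m ih =>
    intro t ht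
    rcases le_total t c with h | h
    · have htc : t ∈ Icc 0 c := ⟨ht.1, h⟩
      obtain ⟨a, b, hab, htab⟩ := ih (f₀ t) (S.branch₀.mapsTo_Icc htc)
      obtain ⟨a', b', ha', hb', rfl, rfl, h'⟩ :=
        step S.branch₀ htc htab (hmem hab).1 (hmem hab).2
      exact ⟨a', b', .left ha' hb' hab, h'⟩
    · have htc : t ∈ Icc c 1 := ⟨h, ht.2⟩
      obtain ⟨a, b, hab, htab⟩ := ih (f₁ t) (S.branch₁.mapsTo_Icc htc)
      obtain ⟨a', b', ha', hb', rfl, rfl, h'⟩ :=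
        step S.branch₁ htc htab (hmem hab).1 (hmem hab).2
      exact ⟨a', b', .right ha' hb' hab, h'⟩

theorem volume_restrict_real_Ioo {a b : ℝ} (hab : a ≤ b) (ha : 0 ≤ a) (hb : b ≤ 1) :
    (volume.restrict (Ioo (0 : ℝ) 1)).real (Ioo a b) = b - a := by
  rw [measureReal_restrict_apply measurableSet_Ioo,
    inter_eq_self_of_subset_left (Ioo_subset_Ioo ha hb), Real.volume_real_Ioo_of_le hab]

/-- Preimages under a branch of intervals of definite mass have definite mass. -/
theorem exists_mass_preimage [IsFiniteMeasure μ] (hμ : μ ≪ volume.restrict (Ioo 0 1))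
    (hη₀ : 0 < η₀)
    (hlow : ∀ A, MeasurableSet A → η₀ * (volume.restrict (Ioo (0 : ℝ) 1)).real A ≤ μ.real A)
    {p q : ℝ} {f f' : ℝ → ℝ} (hb : KoebeBranch p q f f') (hp : 0 ≤ p) (hq : q ≤ 1)
    {r : ℝ} (hr : 0 < r) :
    ∃ ρ > (0 : ℝ), ∀ a ∈ Icc p q, ∀ b ∈ Icc p q, r ≤ μ.real (Ioo (f a) (f b)) →
      ρ ≤ μ.real (Ioo a b) := by
  -- Mass at least r forces the image to have length at least η, by absolute continuity; uniform
  -- continuity of the branch then makes the preimage long, and `hlow` turns length back into mass.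
  obtain ⟨η, hη, hs⟩ := exists_real_lt_of_absolutelyContinuous hμ hr
  obtain ⟨ρ, hρ, hu⟩ := Metric.uniformContinuousOn_iff.1
    (isCompact_Icc.uniformContinuousOn_of_continuous hb.cont) η hη
  refine ⟨η₀ * ρ, mul_pos hη₀ hρ, fun a ha b hb' hrab => ?_⟩
  have hab : a ≤ b := by
    by_contra hlt
    have := hb.strictMonoOn hb' ha (not_le.1 hlt)
    rw [Ioo_eq_empty (not_lt.2 this.le), measureReal_empty] at hrab
    linarith
  have hlen : ρ ≤ b - a := by
    by_contra hlt
    have hd : dist b a < ρ := by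
      rw [Real.dist_eq, abs_of_nonneg (sub_nonneg.2 hab)]
      exact not_le.1 hlt
    have h1 := (le_abs_self _).trans_lt (Real.dist_eq _ _ ▸ hu b hb' a ha hd)
    have h2 := hs _ measurableSet_Ioo (by
      rwa [volume_restrict_real_Ioo (hb.strictMonoOn.monotoneOn ha hb' hab)
        (hb.mapsTo_Icc ha).1 (hb.mapsTo_Icc hb').2])
    linarith
  have h3 := hlow (Ioo a b) measurableSet_Ioo
  rw [volume_restrict_real_Ioo hab (hp.trans ha.1) (hb'.2.trans hq)] at h3
  exact (mul_le_mul_of_nonneg_left hlen hη₀.le).trans h3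

theorem real_eq_add_of_measurePreserving [IsFiniteMeasure μ] (S : FullSystem T c f₀ f₀' f₁ f₁')
    (hT : MeasurePreserving T μ μ) (hμ : μ ≪ volume.restrict (Ioo 0 1)) {a b a' b' : ℝ}
    (ha : a ∈ Icc 0 c) (hb : b ∈ Icc 0 c) (ha' : a' ∈ Icc c 1) (hb' : b' ∈ Icc c 1)
    (haa' : f₀ a = f₁ a') (hbb' : f₀ b = f₁ b') :
    μ.real (Ioo (f₀ a) (f₀ b)) = μ.real (Ioo a b) + μ.real (Ioo a' b') := by
  have hm : MeasurableSet (T ⁻¹' Ioo (f₀ a) (f₀ b)) := S.meas measurableSet_Ioo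
  have h1 : μ.real (Ioo (f₀ a) (f₀ b)) = μ.real (T ⁻¹' Ioo (f₀ a) (f₀ b)) := by
    rw [measureReal_def, measureReal_def, hT.measure_preimage measurableSet_Ioo.nullMeasurableSet]
  rw [h1, ← S.branch₀.preimage_Ioo S.eq₀ ha hb, ← S.branch₁.preimage_Ioo S.eq₁ ha' hb', ← haa',
    ← hbb', measureReal_def, measureReal_def, measureReal_def,
    ← ENNReal.toReal_add (measure_ne_top _ _) (measure_ne_top _ _), ← Measure.restrict_apply hm,
    ← Measure.restrict_apply hm, ← Measure.add_apply, ← eq_restrict_add c hμ]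

/-- Cylinders of high level are short. -/
theorem exists_cylinder_length_lt [IsProbabilityMeasure μ] (S : FullSystem T c f₀ f₀' f₁ f₁')
    (hT : MeasurePreserving T μ μ) (hμ : μ ≪ volume.restrict (Ioo 0 1)) (hη₀ : 0 < η₀)
    (hlow : ∀ A, MeasurableSet A → η₀ * (volume.restrict (Ioo (0 : ℝ) 1)).real A ≤ μ.real A)
    {r : ℝ} (hr : 0 < r) : ∃ m, ∀ a b, Cylinder c f₀ f₁ m a b → b - a < r := by
  obtain ⟨ρ₀, hρ₀, h₀⟩ := exists_mass_preimage hμ hη₀ hlow S.branch₀ le_rfl S.branch₁.lt.le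
    (mul_pos hη₀ hr)
  obtain ⟨ρ₁, hρ₁, h₁⟩ := exists_mass_preimage hμ hη₀ hlow S.branch₁ S.branch₀.lt.le le_rfl
    (mul_pos hη₀ hr)
  -- By invariance the image of a cylinder has its mass plus that of the sibling interval under the
  -- other branch. As long as the mass is at least η₀r, the sibling contributes at least min ρ₀ ρ₁.
  -- The total mass 1 therefore bounds the level of any long cylinder.
  have key : ∀ m a b, Cylinder c f₀ f₁ m a b → η₀ * r ≤ μ.real (Ioo a b) →
      μ.real (Ioo a b) + m * min ρ₀ ρ₁ ≤ 1 := by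
    intro m a b h
    induction h with
    | zero => intro _; simp
    | @left m a b ha hb _ ih =>
      intro hm
      obtain ⟨a', ha', haa'⟩ := S.branch₁.exists_eq (S.branch₀.mapsTo_Icc ha)
      obtain ⟨b', hb', hbb'⟩ := S.branch₁.exists_eq (S.branch₀.mapsTo_Icc hb)
      have e := S.real_eq_add_of_measurePreserving hT hμ ha hb ha' hb' haa'.symm hbb'.symm
      have e0 : 0 ≤ μ.real (Ioo a' b') := measureReal_nonneg
      have i := ih (by linarith)
      have g := h₁ a' ha' b' hb' (by rw [haa', hbb']; linarith)
      have := min_le_right ρ₀ ρ₁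
      push_cast
      linarith
    | @right m a b ha hb _ ih =>
      intro hm
      obtain ⟨a', ha', haa'⟩ := S.branch₀.exists_eq (S.branch₁.mapsTo_Icc ha)
      obtain ⟨b', hb', hbb'⟩ := S.branch₀.exists_eq (S.branch₁.mapsTo_Icc hb)
      have e := S.real_eq_add_of_measurePreserving hT hμ ha' hb' ha hb haa' hbb'
      rw [haa', hbb'] at e
      have e0 : 0 ≤ μ.real (Ioo a' b') := measureReal_nonneg
      have i := ih (by linarith)
      have g := h₀ a' ha' b' hb' (by rw [haa', hbb']; linarith)
      have := min_le_left ρ₀ ρ₁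
      push_cast
      linarith
  have hρ : 0 < min ρ₀ ρ₁ := lt_min hρ₀ hρ₁
  obtain ⟨m, hm⟩ := exists_nat_gt (1 / min ρ₀ ρ₁)
  refine ⟨m, fun a b hab => ?_⟩
  by_contra hlt
  have hmr := (div_lt_iff₀ hρ).1 hm
  have hab01 : 0 ≤ a ∧ b ≤ 1 := by
    cases hab with
    | zero => exact ⟨le_rfl, le_rfl⟩
    | left ha hb _ => exact ⟨ha.1, hb.2.trans S.branch₁.lt.le⟩
    | right ha hb _ => exact ⟨S.branch₀.lt.le.trans ha.1, hb.2⟩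
  have h3 := hlow (Ioo a b) measurableSet_Ioo
  rw [volume_restrict_real_Ioo (by linarith) hab01.1 hab01.2] at h3
  have h4 : η₀ * r ≤ η₀ * (b - a) := mul_le_mul_of_nonneg_left (not_lt.1 hlt) hη₀.le
  have h5 := key m a b hab (h4.trans h3)
  have h6 : 0 ≤ μ.real (Ioo a b) := measureReal_nonneg
  linarith

/-- If an invariant set has a definite proportion for all Koebe measures, it has the same
proportion in all intervals between end points of cylinders. -/
theorem mul_real_Ioo_le (S : FullSystem T c f₀ f₀' f₁ f₁') {A : Set ℝ} (hA : MeasurableSet A)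
    (hinv : T ⁻¹' A = A) {η : ℝ}
    (hη : ∀ κ : Measure ℝ, IsFiniteMeasure κ → KoebeMeasure κ → η * κ.real univ ≤ κ.real A)
    (m : ℕ) : ∀ κ : Measure ℝ, IsFiniteMeasure κ → KoebeMeasure κ →
      ∀ a ∈ cylinderEndpoints c f₀ f₁ m, ∀ b ∈ cylinderEndpoints c f₀ f₁ m, a ≤ b →
        η * κ.real (Ioo a b) ≤ κ.real (A ∩ Ioo a b) := by
  have htriv : ∀ (κ : Measure ℝ) (a : ℝ), η * κ.real (Ioo a a) ≤ κ.real (A ∩ Ioo a a) :=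
    fun κ a => by simp
  induction m with
  | zero =>
    intro κ _ hκ a ha b hb hab
    rcases ha with rfl | rfl <;> rcases hb with rfl | rfl
    · exact htriv κ 0
    · have h1 : κ.real (Ioo 0 1) = κ.real univ := by
        rw [measureReal_def, measureReal_def, measure_eq_measure_of_null_sdiff (subset_univ _)
          (by rw [← compl_eq_univ_sdiff]; exact hκ.compl_Ioo)]
      have h2 : κ.real (A ∩ Ioo 0 1) = κ.real A := by
        rw [measureReal_def, measureReal_def, measure_inter_conull' ?_]
        exact measure_mono_null (fun x hx => hx.2) hκ.compl_Ioo
      rw [h1, h2]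
      exact hη κ inferInstance hκ
    · exact absurd hab (by norm_num)
    · exact htriv κ 1
  | succ m ih =>
    -- The induction runs over all Koebe measures because the induction hypothesis is applied to the
    -- push-forward of κ along one branch; invariance of `A` carries the proportion back.
    have branch : ∀ {p q : ℝ} {f f' : ℝ → ℝ}, KoebeBranch p q f f' → EqOn T f (Ioo p q) →
        0 ≤ p → q ≤ 1 → ∀ κ : Measure ℝ, IsFiniteMeasure κ → KoebeMeasure κ →
        ∀ a ∈ Icc p q, ∀ b ∈ Icc p q, f a ∈ cylinderEndpoints c f₀ f₁ m →
        f b ∈ cylinderEndpoints c f₀ f₁ m → a ≤ b →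
        η * κ.real (Ioo a b) ≤ κ.real (A ∩ Ioo a b) := by
      intro p q f f' hb hTf hp hq κ _ hκ a ha b hb' hfa hfb hab
      have h := ih ((κ.restrict (Ioo p q)).map T) inferInstance
        (hκ.map_branch hb hp hq S.meas hTf) _ hfa _ hfb (hb.strictMonoOn.monotoneOn ha hb' hab)
      rw [map_measureReal_apply S.meas measurableSet_Ioo,
        map_measureReal_apply S.meas (hA.inter measurableSet_Ioo),
        measureReal_restrict_apply (S.meas measurableSet_Ioo),
        measureReal_restrict_apply (S.meas (hA.inter measurableSet_Ioo)), preimage_inter,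
        inter_assoc, hb.preimage_Ioo hTf ha hb', hinv] at h
      exact h
    intro κ _ hκ a ha b hb hab
    rcases ha with ⟨ha, hfa⟩ | ⟨ha, hfa⟩ <;> rcases hb with ⟨hb, hfb⟩ | ⟨hb, hfb⟩
    · exact branch S.branch₀ S.eq₀ le_rfl S.branch₁.lt.le κ inferInstance hκ a ha b hb hfa hfb hab
    -- The interval straddles c and is split there. The point c is itself an end point of the new
    -- level, since its two branch values are 1 and 0.
    · have hend : ∀ m, (0 : ℝ) ∈ cylinderEndpoints c f₀ f₁ m ∧
          (1 : ℝ) ∈ cylinderEndpoints c f₀ f₁ m := by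
        intro m
        induction m with
        | zero => exact ⟨Or.inl rfl, Or.inr rfl⟩
        | succ m ihm =>
          exact ⟨Or.inl ⟨left_mem_Icc.2 S.branch₀.lt.le, by rw [S.branch₀.left]; exact ihm.1⟩,
            Or.inr ⟨right_mem_Icc.2 S.branch₁.lt.le, by rw [S.branch₁.right]; exact ihm.2⟩⟩
      have h1 := branch S.branch₀ S.eq₀ le_rfl S.branch₁.lt.le κ inferInstance hκ a ha c
        (right_mem_Icc.2 S.branch₀.lt.le) hfa (by rw [S.branch₀.right]; exact (hend m).2) ha.2
      have h2 := branch S.branch₁ S.eq₁ S.branch₀.lt.le le_rfl κ inferInstance hκ c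
        (left_mem_Icc.2 S.branch₁.lt.le) b hb (by rw [S.branch₁.left]; exact (hend m).1) hfb hb.1
      have hdis : Disjoint (Ioo a c) (Ioo c b) :=
        disjoint_left.2 fun x hx hx' => absurd hx.2 (not_lt.2 hx'.1.le)
      have hae : ∀ B, κ.real (B ∩ Ioo a b) ≤ κ.real (B ∩ Ioo a c) + κ.real (B ∩ Ioo c b) := by
        intro B
        have hsub : B ∩ Ioo a b ⊆ (B ∩ Ioo a c ∪ B ∩ Ioo c b) ∪ {c} := by
          rintro x ⟨hxB, hx⟩
          rcases lt_trichotomy x c with h | h | h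
          · exact Or.inl (Or.inl ⟨hxB, hx.1, h⟩)
          · exact Or.inr h
          · exact Or.inl (Or.inr ⟨hxB, h, hx.2⟩)
        have hz : κ.real {c} = 0 := by rw [measureReal_def, hκ.noAtoms c, ENNReal.toReal_zero]
        have u1 := measureReal_mono (μ := κ) hsub
        have u2 := measureReal_union_le (μ := κ) (B ∩ Ioo a c ∪ B ∩ Ioo c b) {c}
        have u3 := measureReal_union_le (μ := κ) (B ∩ Ioo a c) (B ∩ Ioo c b)
        linarith
      have hle : κ.real (A ∩ Ioo a c) + κ.real (A ∩ Ioo c b) ≤ κ.real (A ∩ Ioo a b) := by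
        rw [← measureReal_union (hdis.mono inter_subset_right inter_subset_right)
          (hA.inter measurableSet_Ioo)]
        refine measureReal_mono (union_subset ?_ ?_)
        · exact inter_subset_inter_right _ (Ioo_subset_Ioo_right hb.1)
        · exact inter_subset_inter_right _ (Ioo_subset_Ioo_left ha.2)
      have heq : κ.real (Ioo a b) = κ.real (Ioo a c) + κ.real (Ioo c b) := by
        refine le_antisymm (by simpa using hae univ) ?_
        rw [← measureReal_union hdis measurableSet_Ioo]
        exact measureReal_mono (union_subset (Ioo_subset_Ioo_right hb.1)
          (Ioo_subset_Ioo_left ha.2))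
      rw [heq, mul_add]
      linarith
    · obtain rfl : a = b := le_antisymm hab (hb.2.trans ha.1)
      exact htriv κ a
    · exact branch S.branch₁ S.eq₁ S.branch₀.lt.le le_rfl κ inferInstance hκ a ha b hb hfa hfb hab

/-- At a Lebesgue density point of the complement, its proportion in small balls tends to 1, whereas
the hypothesis keeps it at most 1 - η. -/
theorem volume_compl_eq_zero {A : Set ℝ} (hA : MeasurableSet A) {η : ℝ} (hη : 0 < η)
    (h : ∀ x y : ℝ, 0 ≤ x → x ≤ y → y ≤ 1 →
      η * (y - x) ≤ (volume.restrict (Ioo (0 : ℝ) 1)).real (A ∩ Ioo x y)) :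
    (volume.restrict (Ioo (0 : ℝ) 1)) Aᶜ = 0 := by
  rw [Measure.restrict_apply hA.compl]
  have hae := Besicovitch.ae_tendsto_measure_inter_div (volume : Measure ℝ) (Aᶜ ∩ Ioo 0 1)
  have hmem := ae_restrict_mem (μ := (volume : Measure ℝ)) (hA.compl.inter (measurableSet_Ioo (a := (0 : ℝ)) (b := 1)))
  have hfalse : ∀ᵐ x ∂(volume : Measure ℝ).restrict (Aᶜ ∩ Ioo 0 1), False := by
    filter_upwards [hae, hmem] with x hx hxm
    have hev : ∀ᶠ r : ℝ in 𝓝[>] 0, volume (Aᶜ ∩ Ioo 0 1 ∩ Metric.closedBall x r) /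
        volume (Metric.closedBall x r) ≤ ENNReal.ofReal (1 - η) := by
      have h1 : ∀ᶠ r : ℝ in 𝓝[>] 0, r ≤ x :=
        (eventually_le_nhds hxm.2.1).filter_mono nhdsWithin_le_nhds
      have h2 : ∀ᶠ r : ℝ in 𝓝[>] 0, r ≤ 1 - x :=
        (eventually_le_nhds (sub_pos.2 hxm.2.2)).filter_mono nhdsWithin_le_nhds
      filter_upwards [h1, h2, self_mem_nhdsWithin] with r hr1 hr2 hr0
      have hr0' : (0 : ℝ) < r := hr0
      have hball : volume (Metric.closedBall x r) = ENNReal.ofReal (2 * r) :=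
        Real.volume_closedBall x r
      rw [hball, ENNReal.div_le_iff (ENNReal.ofReal_pos.2 (by linarith)).ne'
        ENNReal.ofReal_ne_top]
      have h3 := h (x - r) (x + r) (by linarith) (by linarith) (by linarith)
      rw [measureReal_restrict_apply (hA.inter measurableSet_Ioo)] at h3
      have hfin : volume (Metric.closedBall x r) ≠ ⊤ := by rw [hball]; exact ENNReal.ofReal_ne_top
      have hsub1 : A ∩ Ioo (x - r) (x + r) ∩ Ioo 0 1 ⊆ Metric.closedBall x r := by
        rintro y ⟨⟨_, hy⟩, _⟩
        rw [Real.closedBall_eq_Icc]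
        exact Ioo_subset_Icc_self hy
      have hdis : Disjoint (Aᶜ ∩ Ioo 0 1 ∩ Metric.closedBall x r)
          (A ∩ Ioo (x - r) (x + r) ∩ Ioo 0 1) :=
        disjoint_left.2 fun y hy hy' => hy.1.1 hy'.1.1
      have h4 := measureReal_union (μ := (volume : Measure ℝ)) hdis
        ((hA.inter measurableSet_Ioo).inter measurableSet_Ioo)
        (measure_ne_top_of_subset inter_subset_right hfin)
        (measure_ne_top_of_subset hsub1 hfin)
      have h5 := measureReal_mono (μ := (volume : Measure ℝ))
        (union_subset (inter_subset_right (s := Aᶜ ∩ Ioo 0 1)) hsub1) hfin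
      have h6 : volume.real (Metric.closedBall x r) = 2 * r := by
        rw [measureReal_def, hball, ENNReal.toReal_ofReal (by linarith)]
      have h8 : volume.real (Aᶜ ∩ Ioo 0 1 ∩ Metric.closedBall x r) ≤ (1 - η) * (2 * r) := by
        linarith
      rw [← ENNReal.ofReal_mul' (by linarith), ← ofReal_measureReal
        (measure_ne_top_of_subset inter_subset_right hfin)]
      exact ENNReal.ofReal_le_ofReal h8
    have := le_of_tendsto hx hev
    rw [ENNReal.one_le_ofReal] at this
    linarith
  rw [ae_iff] at hfalse
  simpa using hfalse

/-- Two-branch systems with a lower bound for all Koebe measures are ergodic. -/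
theorem ergodic [IsProbabilityMeasure μ] (S : FullSystem T c f₀ f₀' f₁ f₁')
    (hT : MeasurePreserving T μ μ) (hμ : μ ≪ volume.restrict (Ioo 0 1)) (hη₀ : 0 < η₀)
    (hlow : ∀ A, MeasurableSet A → η₀ * (volume.restrict (Ioo (0 : ℝ) 1)).real A ≤ μ.real A)
    (hev : ∀ κ : Measure ℝ, IsFiniteMeasure κ → KoebeMeasure κ → ∃ n : ℕ, ∀ A, MeasurableSet A →
      η₀ * κ.real univ * (volume.restrict (Ioo (0 : ℝ) 1)).real A ≤ (κ.map T^[n]).real A) :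
    Ergodic T μ := by
  refine ⟨hT, ⟨fun A hA hinv => ?_⟩⟩
  rw [eventuallyConst_set']
  rcases eq_or_ne ((volume.restrict (Ioo (0 : ℝ) 1)) A) 0 with h0 | h0
  · exact Or.inl (ae_eq_empty.2 (hμ h0))
  right
  have hpos : 0 < (volume.restrict (Ioo (0 : ℝ) 1)).real A :=
    ENNReal.toReal_pos h0 (measure_ne_top _ _)
  set η := η₀ * (volume.restrict (Ioo (0 : ℝ) 1)).real A with hηdef
  have hη : 0 < η := mul_pos hη₀ hpos
  have hinvn : ∀ n : ℕ, T^[n] ⁻¹' A = A := fun n => by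
    induction n with
    | zero => rfl
    | succ n ih => rw [Function.iterate_succ, preimage_comp, ih, hinv]
  -- Since `A` is invariant, the eventual lower bound for the iterates of κ is already one for κ
  -- itself.
  have hκ : ∀ κ : Measure ℝ, IsFiniteMeasure κ → KoebeMeasure κ →
      η * κ.real univ ≤ κ.real A := by
    intro κ _ hk
    obtain ⟨n, hn⟩ := hev κ inferInstance hk
    have := hn A hA
    rw [map_measureReal_apply (S.meas.iterate n) hA, hinvn n] at this
    calc η * κ.real univ = η₀ * κ.real univ * (volume.restrict (Ioo (0 : ℝ) 1)).real A := by
          rw [hηdef]; ring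
      _ ≤ _ := this
  have hint : ∀ x y : ℝ, 0 ≤ x → x ≤ y → y ≤ 1 →
      η * (y - x) ≤ (volume.restrict (Ioo (0 : ℝ) 1)).real (A ∩ Ioo x y) := by
    intro x y hx hxy hy
    refine le_of_forall_pos_le_add fun ε hε => ?_
    rcases eq_or_lt_of_le hxy with rfl | hlt
    · simp [hε.le]
    -- Replacing x and y by end points of cylinders inside the interval loses length at most 2r, at
    -- cost 2ηr ≤ ε. The second bound keeps the new end points in order.
    set r := min (ε / (2 * η)) ((y - x) / 2) with hr
    have hr0 : 0 < r := lt_min (by positivity) (by linarith)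
    have hr1 : r ≤ ε / (2 * η) := min_le_left _ _
    have hr2 : r ≤ (y - x) / 2 := min_le_right _ _
    obtain ⟨m, hm⟩ := S.exists_cylinder_length_lt hT hμ hη₀ hlow hr0
    obtain ⟨a', a, ha, hat⟩ := S.exists_cylinder m x ⟨hx, by linarith⟩
    obtain ⟨b, b', hb, hbt⟩ := S.exists_cylinder m y ⟨by linarith, hy⟩
    have l1 := hm _ _ ha
    have l2 := hm _ _ hb
    have hax : x ≤ a := hat.2
    have hax' : a ≤ x + r := by linarith [hat.1]
    have hby : b ≤ y := hbt.1
    have hby' : y - r ≤ b := by linarith [hbt.2]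
    have h1 := S.mul_real_Ioo_le hA hinv hκ m _ inferInstance KoebeMeasure.volume_restrict a
      ha.mem_endpoints.2 b hb.mem_endpoints.1 (by linarith)
    rw [volume_restrict_real_Ioo (by linarith) (by linarith) (by linarith)] at h1
    have h2 : (volume.restrict (Ioo (0 : ℝ) 1)).real (A ∩ Ioo a b) ≤
        (volume.restrict (Ioo (0 : ℝ) 1)).real (A ∩ Ioo x y) :=
      measureReal_mono (inter_subset_inter_right _ (Ioo_subset_Ioo hax hby))
    have h3 : η * (2 * r) ≤ ε := by
      have := (le_div_iff₀ (by positivity)).1 hr1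
      linarith
    have h4 : η * (y - x - 2 * r) ≤ η * (b - a) := mul_le_mul_of_nonneg_left (by linarith) hη.le
    linarith
  exact ae_eq_univ.2 (hμ (volume_compl_eq_zero hA hη hint))

end FullSystem

namespace FullSystem

variable {T : ℝ → ℝ} {c : ℝ} {f₀ f₀' f₁ f₁' : ℝ → ℝ} {θ s C β δ₁ δ : ℝ}

/-- Half of the mass in [δ,1-δ] gives, by Harnack, a density at least δ²/2 times the total mass. For
the iterates of Lebesgue measure this holds at all times and passes to the limit measure; for other
Koebe measures it holds at some time, which is what ergodicity needs. -/
theorem exists_ergodic (S : FullSystem T c f₀ f₀' f₁ f₁')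
    (Q : Quantified θ s C β δ₁ c f₀ f₁) (hθ : θ ∈ Ioo (0 : ℝ) 1) (hC : 0 < C) (hβ : 0 < β)
    (hδ₁ : 0 < δ₁) (hδ : 0 < δ) (hδs : δ ≤ s)
    (hδc : 2 * δ + 2 * (C / δ₁ ^ 2 / (1 - θ ^ β) * δ ^ β) ≤ 1 / 4) :
    ∃ μ : Measure ℝ, IsProbabilityMeasure μ ∧ μ ≪ volume.restrict (Ioo 0 1) ∧ Ergodic T μ ∧
      ∀ A, MeasurableSet A →
        δ ^ 2 / 2 * (volume.restrict (Ioo (0 : ℝ) 1)).real A ≤ μ.real A := by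
  have hprob : IsProbabilityMeasure (volume.restrict (Ioo (0 : ℝ) 1)) := ⟨by simp⟩
  obtain ⟨μ, hμ, hTμ, hac, hlow⟩ := exists_invariant_of_uniform_absolutelyContinuous S.meas
    (volume.restrict (Ioo (0 : ℝ) 1)) (volume.restrict (Ioo (0 : ℝ) 1))
    (fun ε hε => S.uniform_absolutelyContinuous Q hθ hC hβ hδ₁ (hδ.trans_le hδs) hε)
  have hstep : ∀ {κ : Measure ℝ} [IsFiniteMeasure κ] {M : ℝ}, KoebeMeasure κ →
      M / 2 ≤ κ.real (Icc δ (1 - δ)) → ∀ A, MeasurableSet A →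
      δ ^ 2 / 2 * M * (volume.restrict (Ioo (0 : ℝ) 1)).real A ≤ κ.real A := by
    intro κ _ M hκ hM A hA
    refine le_trans (mul_le_mul_of_nonneg_right ?_ measureReal_nonneg) (lower_bound hκ hδ hA)
    have := mul_le_mul_of_nonneg_left hM (sq_nonneg δ)
    linarith
  have hlow' : ∀ A, MeasurableSet A →
      δ ^ 2 / 2 * (volume.restrict (Ioo (0 : ℝ) 1)).real A ≤ μ.real A := fun A hA => by
    refine hlow _ A hA fun n => ?_
    have := hstep (M := 1) (S.koebeMeasure_iterate KoebeMeasure.volume_restrict n)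
      (S.half_le_lebesgue_iterate Q hθ hC hβ hδ₁ hδ hδs hδc n) A hA
    rwa [mul_one] at this
  refine ⟨μ, hμ, hac, S.ergodic hTμ hac (by positivity) hlow' fun κ _ hκ => ?_, hlow'⟩
  obtain ⟨n, hn⟩ := S.exists_half_le_iterate Q hθ hC hβ hδ₁ hδ hδs hδc hκ
  exact ⟨n, hstep (S.koebeMeasure_iterate hκ n) hn⟩

end FullSystem

/-! ### The constants for maps close to standard ones. -/

/-- The function 1 - (1-t)^α has derivative α > b at 0. -/
theorem exists_mul_le_one_sub_rpow {α b : ℝ} (hb : b < α) :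
    ∃ s, 0 < s ∧ s < 1 ∧ ∀ t, 0 < t → t ≤ s → b * t ≤ 1 - (1 - t) ^ α := by
  have h : HasDerivAt (fun t : ℝ => 1 - (1 - t) ^ α) α 0 := by
    have h1 := ((Real.hasDerivAt_rpow_const (x := 1 - (0 : ℝ)) (p := α)
      (Or.inl (by norm_num))).comp (0 : ℝ) ((hasDerivAt_id (0 : ℝ)).const_sub 1)).const_sub 1
    exact h1.congr_deriv (by simp)
  have h2 := ((hasDerivAt_iff_tendsto_slope.1 h).mono_left
    (nhdsWithin_mono _ fun x (hx : (0 : ℝ) < x) => hx.ne')).eventually (lt_mem_nhds hb)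
  obtain ⟨u, hu, hsub⟩ := mem_nhdsGT_iff_exists_Ioc_subset.1 h2
  have hu0 : (0 : ℝ) < u := hu
  refine ⟨min u (1 / 2), lt_min hu0 (by norm_num), (min_le_right _ _).trans_lt (by norm_num),
    fun t ht hts => ?_⟩
  have h3 : b < slope (fun t : ℝ => 1 - (1 - t) ^ α) 0 t := hsub ⟨ht, hts.trans (min_le_left _ _)⟩
  rw [slope_def_field] at h3
  simp only [sub_zero, Real.one_rpow, sub_self] at h3
  rw [lt_div_iff₀ ht] at h3
  exact h3.le

theorem koebeBranch_leftBranch {α c : ℝ} {φ : ℝ → ℝ} (hα : 1 < α) (hc : 0 < c)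
    (hφ : IsDiffeoPart φ) : ∃ f', KoebeBranch 0 c (leftBranch α c 1 φ) f' := by
  refine ⟨_, (hφ.koebeBranch.comp ((koebeBranch_rpow hα).reflect.comp
    (KoebeBranch.affine hc))).congr_fun fun x _ => ?_⟩
  have : (c - x) / c = 1 - (x - 0) / (c - 0) := by
    rw [sub_zero, sub_zero, sub_div, div_self hc.ne']
  simp only [leftBranch, stdLeft, this, one_mul]

theorem koebeBranch_rightBranch {α c : ℝ} {φ : ℝ → ℝ} (hα : 1 < α) (hc : c < 1)
    (hφ : IsDiffeoPart φ) : ∃ f', KoebeBranch c 1 (rightBranch α c 1 φ) f' := by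
  refine ⟨_, (hφ.koebeBranch.comp ((koebeBranch_rpow hα).comp
    (KoebeBranch.affine hc))).congr_fun fun x _ => ?_⟩
  simp only [rightBranch, stdRight]
  congr 1
  ring

theorem le_mul_of_rpow_le {a z y β α : ℝ} (hα : 0 < α) (hβ : β = 1 / α) (ha : 0 < a) (hz : 0 ≤ z)
    (hy : 0 ≤ y) (h : a * z ^ α ≤ y) : z ≤ (1 / a) ^ β * y ^ β := by
  subst hβ
  have h1 : z ^ α ≤ 1 / a * y := by
    rw [one_div, inv_mul_eq_div, le_div_iff₀ ha]
    linarith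
  have h2 := Real.rpow_le_rpow (Real.rpow_nonneg hz α) h1 (by positivity : 0 ≤ 1 / α)
  rwa [← Real.rpow_mul hz, mul_one_div_cancel hα.ne', Real.rpow_one,
    Real.mul_rpow (by positivity) hy] at h2

theorem le_mul_of_rpow_expansion {α a b s₀ x y G : ℝ} (hα : 0 < α) (ha : 0 < a) (hab : 1 < a * b)
    (hs₀ : 0 < s₀) (hs₁ : s₀ < 1) (h₀ : ∀ t, 0 < t → t ≤ s₀ → b * t ≤ 1 - (1 - t) ^ α)
    (hx : 0 < x) (hxy : x ≤ y) (hy : y < 1) (hG : a * (1 - (1 - y) ^ α) ≤ G) (hGs : G ≤ s₀) :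
    x ≤ 1 / (a * b) * G := by
  have hab0 : 0 < a * b := by linarith
  rw [one_div, inv_mul_eq_div, le_div_iff₀ hab0]
  rcases le_or_gt y s₀ with h | h
  · have h1 := mul_le_mul_of_nonneg_left (h₀ y (hx.trans_le hxy) h) ha.le
    nlinarith
  -- Here y lies outside the range of the linear bound, but monotonicity gives G ≥ a b s₀ > s₀.
  · exfalso
    have h1 := mul_le_mul_of_nonneg_left (h₀ s₀ hs₀ le_rfl) ha.le
    have h2 : (1 - y) ^ α ≤ (1 - s₀) ^ α := Real.rpow_le_rpow (by linarith) (by linarith) hα.le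
    nlinarith

/-- Rescaling [0,c] or [c,1] to the unit interval only increases slopes, so the expansion ab and the
Hölder constant do not depend on c. The position of c enters only through `hcK`: the critical
neighbourhood has radius at most 1/(2K), hence stays 1/(2K) away from 0 and 1. -/
theorem quantified_branches {α a b s₀ s K c : ℝ} {φl φr : ℝ → ℝ} (hα : 1 < α) (ha : 0 < a)
    (hab : 1 < a * b) (hs₀ : 0 < s₀) (hs₁ : s₀ < 1)
    (h₀ : ∀ t, 0 < t → t ≤ s₀ → b * t ≤ 1 - (1 - t) ^ α) (hs : s ≤ s₀)
    (hsK : (1 / a) ^ (1 / α) * s ^ (1 / α) ≤ 1 / K / 2) (hc : c ∈ Ioo (0 : ℝ) 1)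
    (hcK : c ∈ Icc (1 / K) (1 - 1 / K)) (hφl : IsDiffeoPart φl) (hφr : IsDiffeoPart φr)
    (hl : C2CloseToId (1 - a) φl) (hr : C2CloseToId (1 - a) φr) :
    Quantified (1 / (a * b)) s ((1 / a) ^ (1 / α)) (1 / α) (1 / K / 2) c
      (leftBranch α c 1 φl) (rightBranch α c 1 φr) := by
  have hα0 : 0 < α := by linarith
  have hc0 := hc.1
  have hc1 : 0 < 1 - c := sub_pos.2 hc.2
  have hpow : ∀ z ∈ Icc (0 : ℝ) 1, z ^ α ∈ Icc (0 : ℝ) 1 := fun z hz =>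
    ⟨Real.rpow_nonneg hz.1 _, Real.rpow_le_one hz.1 hz.2 hα0.le⟩
  have hleft : ∀ x ∈ Ioo 0 c, (c - x) / c ∈ Icc (0 : ℝ) 1 ∧
      a * (1 - ((c - x) / c) ^ α) ≤ leftBranch α c 1 φl x ∧
      a * ((c - x) / c) ^ α ≤ 1 - leftBranch α c 1 φl x := by
    intro x hx
    have hm : (c - x) / c ∈ Icc (0 : ℝ) 1 :=
      ⟨div_nonneg (by linarith [hx.2]) hc0.le, (div_le_one hc0).2 (by linarith [hx.1])⟩
    have hp := hpow _ hm
    have h1 := hφl.mul_le_of_close hl (z := 1 - ((c - x) / c) ^ α)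
      ⟨by linarith [hp.2], by linarith [hp.1]⟩
    simp only [leftBranch, stdLeft, one_mul]
    exact ⟨hm, by linarith [h1.1], by linarith [h1.2]⟩
  have hright : ∀ x ∈ Ioo c 1, (x - c) / (1 - c) ∈ Icc (0 : ℝ) 1 ∧
      a * ((x - c) / (1 - c)) ^ α ≤ rightBranch α c 1 φr x ∧
      a * (1 - ((x - c) / (1 - c)) ^ α) ≤ 1 - rightBranch α c 1 φr x := by
    intro x hx
    have hm : (x - c) / (1 - c) ∈ Icc (0 : ℝ) 1 :=
      ⟨div_nonneg (by linarith [hx.1]) hc1.le, (div_le_one hc1).2 (by linarith [hx.2])⟩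
    have h1 := hφr.mul_le_of_close hr (hpow _ hm)
    have e : stdRight α c 1 x = ((x - c) / (1 - c)) ^ α := by simp only [stdRight]; ring
    simp only [rightBranch, e]
    exact ⟨hm, by linarith [h1.1], by linarith [h1.2]⟩
  refine ⟨fun x hx hxs => ?_, fun x hx hxs => ?_, fun x hx => ?_, fun x hx => ?_, ?_, ?_⟩
  · obtain ⟨hm, h1, _⟩ := hleft x hx
    have e : (c - x) / c = 1 - x / c := by field_simp
    rw [e] at h1
    exact le_mul_of_rpow_expansion hα0 ha hab hs₀ hs₁ h₀ hx.1
      ((le_div_iff₀ hc0).2 (by nlinarith [hx.1, hc.2])) ((div_lt_one hc0).2 hx.2) h1 (hxs.trans hs)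
  · obtain ⟨hm, _, h1⟩ := hright x hx
    have e : (x - c) / (1 - c) = 1 - (1 - x) / (1 - c) := by field_simp; ring
    rw [e] at h1
    exact le_mul_of_rpow_expansion hα0 ha hab hs₀ hs₁ h₀ (sub_pos.2 hx.2)
      ((le_div_iff₀ hc1).2 (by nlinarith [hx.2])) ((div_lt_one hc1).2 (by linarith [hx.1])) h1
      (hxs.trans hs)
  · obtain ⟨hm, _, h1⟩ := hleft x hx
    have h2 := le_mul_of_rpow_le hα0 rfl ha hm.1
      (le_trans (mul_nonneg ha.le (hpow _ hm).1) h1) h1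
    refine le_trans ((le_div_iff₀ hc0).2 ?_) h2
    nlinarith [hx.2, hc.2]
  · obtain ⟨hm, h1, _⟩ := hright x hx
    have h2 := le_mul_of_rpow_le hα0 rfl ha hm.1
      (le_trans (mul_nonneg ha.le (hpow _ hm).1) h1) h1
    refine le_trans ((le_div_iff₀ hc1).2 ?_) h2
    nlinarith [hx.1]
  · linarith [hcK.1]
  · linarith [hcK.2]

end Lorenz

/-! ### From full Lorenz maps to two-branch systems. -/

namespace LorenzMap

open Lorenz

variable {α : ℝ}

/-- The standard branch never exceeds u, and the diffeomorphic part takes the value 1 only at 1. -/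
theorem IsFull.u_eq_one (hα : 1 < α) {f : LorenzMap α} (h : f.IsFull) : f.u = 1 := by
  have h1 : (1 : ℝ) ∈ Icc (0 : ℝ) 1 := right_mem_Icc.2 zero_le_one
  obtain ⟨x, hx, hfx⟩ := (h.1.symm ▸ h1 : (1 : ℝ) ∈ leftBranch α f.c f.u f.φl '' Icc 0 f.c)
  have hm : 0 ≤ (f.c - x) / f.c := div_nonneg (sub_nonneg.2 hx.2) f.c_mem.1.le
  have hp0 : 0 ≤ ((f.c - x) / f.c) ^ α := Real.rpow_nonneg hm _
  have hp1 : ((f.c - x) / f.c) ^ α ≤ 1 := Real.rpow_le_one hm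
    ((div_le_one f.c_mem.1).2 (by linarith [hx.1])) (by linarith)
  have hu := mul_nonneg f.u_mem.1 hp0
  have hu' := mul_nonneg f.u_mem.1 (sub_nonneg.2 hp1)
  have hle : stdLeft α f.c f.u x ≤ f.u := by
    simp only [stdLeft]
    linarith
  have heq : stdLeft α f.c f.u x = 1 := f.diffeo_left.bijOn.injOn
    ⟨hu', hle.trans f.u_mem.2⟩ h1 (hfx.trans f.diffeo_left.map_one.symm)
  exact le_antisymm f.u_mem.2 (heq ▸ hle)

theorem IsFull.v_eq_one (hα : 1 < α) {f : LorenzMap α} (h : f.IsFull) : f.v = 1 := by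
  have h0 : (0 : ℝ) ∈ Icc (0 : ℝ) 1 := left_mem_Icc.2 zero_le_one
  obtain ⟨x, hx, hfx⟩ := (h.2.symm ▸ h0 : (0 : ℝ) ∈ rightBranch α f.c f.v f.φr '' Icc f.c 1)
  have hc1 : 0 < 1 - f.c := sub_pos.2 f.c_mem.2
  have hm : 0 ≤ (x - f.c) / (1 - f.c) := div_nonneg (sub_nonneg.2 hx.1) hc1.le
  have hp0 : 0 ≤ ((x - f.c) / (1 - f.c)) ^ α := Real.rpow_nonneg hm _
  have hp1 : ((x - f.c) / (1 - f.c)) ^ α ≤ 1 := Real.rpow_le_one hm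
    ((div_le_one hc1).2 (by linarith [hx.2])) (by linarith)
  have hv := mul_nonneg f.v_mem.1 hp0
  have hv' := mul_nonneg f.v_mem.1 (sub_nonneg.2 hp1)
  have hle : 1 - f.v ≤ stdRight α f.c f.v x := by
    simp only [stdRight]
    linarith
  have hle1 : stdRight α f.c f.v x ≤ 1 := by
    simp only [stdRight]
    linarith
  have heq : stdRight α f.c f.v x = 0 := f.diffeo_right.bijOn.injOn
    ⟨(sub_nonneg.2 f.v_mem.2).trans hle, hle1⟩ h0 (hfx.trans f.diffeo_right.map_zero.symm)
  linarith [f.v_mem.2]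

theorem exists_fullSystem (hα : 1 < α) {f : LorenzMap α} (h : f.IsFull) :
    ∃ (T : ℝ → ℝ) (f₀' f₁' : ℝ → ℝ),
      FullSystem T f.c (leftBranch α f.c 1 f.φl) f₀' (rightBranch α f.c 1 f.φr) f₁' ∧
      EqOn T f.toFun (Ioo 0 f.c ∪ Ioo f.c 1) := by
  obtain ⟨f₀', h₀⟩ := koebeBranch_leftBranch hα f.c_mem.1 f.diffeo_left
  obtain ⟨f₁', h₁⟩ := koebeBranch_rightBranch hα f.c_mem.2 f.diffeo_right
  -- The given branches are arbitrary outside their intervals and need not be measurable there;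
  -- constant extension makes them continuous on the line.
  let F₀ := IccExtend h₀.lt.le ((Icc 0 f.c).domRestrict (leftBranch α f.c 1 f.φl))
  let F₁ := IccExtend h₁.lt.le ((Icc f.c 1).domRestrict (rightBranch α f.c 1 f.φr))
  have hF₀ : Continuous F₀ := h₀.cont.domRestrict.Icc_extend'
  have hF₁ : Continuous F₁ := h₁.cont.domRestrict.Icc_extend'
  let T : ℝ → ℝ := fun x => if x < f.c then F₀ x else F₁ x
  have e₀ : EqOn T (leftBranch α f.c 1 f.φl) (Ioo 0 f.c) := fun x hx => by
    simp only [T, if_pos hx.2, F₀]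
    rw [IccExtend_of_mem _ _ (Ioo_subset_Icc_self hx), domRestrict_apply]
  have e₁ : EqOn T (rightBranch α f.c 1 f.φr) (Ioo f.c 1) := fun x hx => by
    simp only [T, if_neg (not_lt.2 hx.1.le), F₁]
    rw [IccExtend_of_mem _ _ (Ioo_subset_Icc_self hx), domRestrict_apply]
  refine ⟨T, f₀', f₁', ⟨Measurable.ite measurableSet_Iio hF₀.measurable hF₁.measurable,
    h₀, h₁, e₀, e₁⟩, fun x hx => ?_⟩
  simp only [toFun, lorenzFun, h.u_eq_one hα, h.v_eq_one hα]
  rcases hx with hx | hx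
  · rw [if_pos hx.2, e₀ hx]
  · rw [if_neg (not_lt.2 hx.1.le), e₁ hx]

/-- Absolute continuity makes c and the complement of (0,1) null, so the choice of `T` there does
not affect invariance. -/
theorem isACIP_iff {f : LorenzMap α} {T : ℝ → ℝ} (hT : Measurable T)
    (hTf : EqOn T f.toFun (Ioo 0 f.c ∪ Ioo f.c 1)) {μ : Measure ℝ} :
    f.IsACIP μ ↔ IsProbabilityMeasure μ ∧ μ ≪ volume.restrict (Ioo 0 1) ∧
      MeasurePreserving T μ μ := by
  have hres : volume.restrict (Icc (0 : ℝ) 1) = volume.restrict (Ioo 0 1) :=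
    Measure.restrict_congr_set Ioo_ae_eq_Icc.symm
  have hset : μ ≪ volume.restrict (Ioo 0 1) → ∀ A : Set ℝ,
      μ {x ∈ Icc (0 : ℝ) 1 \ {f.c} | f.toFun x ∈ A} = μ (T ⁻¹' A) := by
    intro hμ A
    have hae : ∀ᵐ x ∂μ, x ∈ Ioo 0 f.c ∪ Ioo f.c 1 := FullSystem.measure_compl_union f.c hμ
    refine measure_congr ?_
    filter_upwards [hae] with x hx
    have hx' : x ∈ Icc (0 : ℝ) 1 \ {f.c} := by
      have := f.c_mem.1
      have := f.c_mem.2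
      rcases hx with hx | hx
      · exact ⟨⟨hx.1.le, by linarith [hx.2]⟩, hx.2.ne⟩
      · exact ⟨⟨by linarith [hx.1], hx.2.le⟩, hx.1.ne'⟩
    refine propext ⟨fun h => ?_, fun h => ⟨hx', ?_⟩⟩
    · change T x ∈ A
      rw [hTf hx]
      exact h.2
    · rw [← hTf hx]
      exact h
  constructor
  · rintro ⟨h1, h2, h3⟩
    rw [hres] at h2
    refine ⟨h1, h2, hT, Measure.ext fun A hA => ?_⟩
    rw [Measure.map_apply hT hA, ← hset h2 A, h3 A hA]
  · rintro ⟨h1, h2, h3⟩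
    refine ⟨h1, by rwa [hres], fun A hA => ?_⟩
    rw [hset h2 A, h3.measure_preimage hA.nullMeasurableSet]

end LorenzMap

end

open Lorenz

theorem mainTheorem6 (α : ℝ) (hα : 1 < α) :
    ∃ ε : ℝ, 0 < ε ∧
      ∀ K : ℝ, 0 < K →
        ∃ w : ℝ, 0 < w ∧
          ∀ f : LorenzMap α, f.IsFull → f.CloseToStandard ε →
            f.c ∈ Icc (1 / K) (1 - 1 / K) →
              (∃! μ : Measure ℝ, f.IsACIP μ) ∧
              ∀ μ : Measure ℝ, f.IsACIP μ →
                w ≤ μ.real (Icc 0 f.c) ∧ w ≤ μ.real (Icc f.c 1) := by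
  have hα0 : 0 < α := by linarith
  -- Choose 1 < b < α and 1/b < a < 1, so that ab > 1. Then ε = 1 - a depends on α alone.
  obtain ⟨b, hb1, hbα⟩ := exists_between hα
  have hb0 : 0 < b := by linarith
  obtain ⟨a, hba, ha1⟩ := exists_between ((div_lt_one hb0).2 hb1)
  have ha0 : 0 < a := (one_div_pos.2 hb0).trans hba
  have hab : 1 < a * b := (div_lt_iff₀ hb0).1 hba
  obtain ⟨s₀, hs₀, hs₁, h₀⟩ := exists_mul_le_one_sub_rpow hbα
  refine ⟨1 - a, sub_pos.2 ha1, fun K hK => ?_⟩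
  set β := 1 / α with hβ
  have hβ0 : 0 < β := one_div_pos.2 hα0
  set C := (1 / a) ^ β with hC
  have hC0 : 0 < C := Real.rpow_pos_of_pos (one_div_pos.2 ha0) _
  have hδ₁ : 0 < 1 / K / 2 := by positivity
  -- The second bound is solved from C s^β ≤ 1/(2K).
  set s := min s₀ ((1 / K / 2 / C) ^ α) with hs
  have hs0 : 0 < s := lt_min hs₀ (Real.rpow_pos_of_pos (by positivity) _)
  have hsK : C * s ^ β ≤ 1 / K / 2 := by
    have h1 : s ^ β ≤ ((1 / K / 2 / C) ^ α) ^ β :=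
      Real.rpow_le_rpow hs0.le (min_le_right _ _) hβ0.le
    rw [← Real.rpow_mul (by positivity), hβ, mul_one_div_cancel hα0.ne', Real.rpow_one,
      le_div_iff₀ hC0] at h1
    linarith
  have hθ : 1 / (a * b) ∈ Ioo (0 : ℝ) 1 :=
    ⟨one_div_pos.2 (by linarith), (div_lt_one (by linarith)).2 hab⟩
  obtain ⟨δ, hδ, hδs, hδc⟩ := exists_tail_const_le
    (C / (1 / K / 2) ^ 2 / (1 - (1 / (a * b)) ^ β)) hβ0 hs0 (show (0 : ℝ) < 1 / 4 by norm_num)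
  -- The density is at least δ²/2 and each side of c has length at least 1/K; δ was fixed before the
  -- map.
  refine ⟨δ ^ 2 / 2 * (1 / K), by positivity, fun f hf hclose hcK => ?_⟩
  obtain ⟨T, f₀', f₁', S, hTf⟩ := LorenzMap.exists_fullSystem hα hf
  have Q := quantified_branches hα ha0 hab hs₀ hs₁ h₀ (min_le_left _ _) hsK f.c_mem hcK
    f.diffeo_left f.diffeo_right hclose.1 hclose.2
  obtain ⟨μ, hμ, hac, herg, hlow⟩ := S.exists_ergodic Q hθ hC0 hβ0 hδ₁ hδ hδs hδc
  have huniq : ∀ ν : Measure ℝ, f.IsACIP ν → ν = μ := by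
    intro ν hν
    obtain ⟨hν1, hν2, hν3⟩ := (LorenzMap.isACIP_iff S.meas hTf).1 hν
    -- The lower density bound makes Lebesgue measure absolutely continuous with respect to μ, hence
    -- so is any competitor, and ergodicity identifies the two.
    have hle : volume.restrict (Ioo 0 1) ≪ μ := Measure.AbsolutelyContinuous.mk fun A hA h0 => by
      have h1 := hlow A hA
      rw [measureReal_def μ, h0, ENNReal.toReal_zero] at h1
      have h2 : (volume.restrict (Ioo (0 : ℝ) 1)).real A ≤ 0 :=
        nonpos_of_mul_nonpos_right h1 (by positivity)
      exact (measureReal_eq_zero_iff (measure_ne_top _ _)).1 (le_antisymm h2 measureReal_nonneg)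
    exact herg.eq_of_absolutelyContinuous hν3 (hν2.trans hle)
  refine ⟨⟨μ, (LorenzMap.isACIP_iff S.meas hTf).2 ⟨hμ, hac, herg.toMeasurePreserving⟩, huniq⟩,
    fun ν hν => ?_⟩
  rw [huniq ν hν]
  have key : ∀ x y : ℝ, 0 ≤ x → x + 1 / K ≤ y → y ≤ 1 →
      δ ^ 2 / 2 * (1 / K) ≤ μ.real (Icc x y) := by
    intro x y hx hxy hy
    have hK' : 0 < 1 / K := by positivity
    have h1 := hlow (Ioo x y) measurableSet_Ioo
    rw [FullSystem.volume_restrict_real_Ioo (by linarith) hx hy] at h1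
    calc δ ^ 2 / 2 * (1 / K) ≤ δ ^ 2 / 2 * (y - x) :=
          mul_le_mul_of_nonneg_left (by linarith) (by positivity)
      _ ≤ μ.real (Ioo x y) := h1
      _ ≤ μ.real (Icc x y) := measureReal_mono Ioo_subset_Icc_self
  exact ⟨key 0 f.c le_rfl (by linarith [hcK.1]) f.c_mem.2.le,
    key f.c 1 f.c_mem.1.le (by linarith [hcK.2]) le_rfl⟩
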